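/- **Setting.** Let $D\subset\mathbb R^d$ be a domain (open, connected, non-empty) and let $$Au(x)=\tfrac12\mathrm{Tr}\big(\mathbf Q(x)\nabla^2u(x)\big)+b(x)\cdot\nabla u(x)+\int_{\mathbb R^d}\Big(u(x+y)-u(x)-\frac{y\cdot\nabla u(x)}{1+|y|^2}\Big)N(x,dy),$$ where $\mathbf Q=[q_{i,j}]$ and $b$ are Borel on $\mathbb R^d$ and bounded on $D$, $\sum_{i,j}q_{i,j}(x)\xi_i\xi_j\ge0$ for $x\in D$, $\xi\in\mathbb R^d$, and $N$ is a Borel measurable kernel of measures on $\mathbb R^d\setminus\{0\}$ with $\sup_{x\in\mathbb R^d}\int\min\{1,|y|^2\}\,N(x,dy)<\infty$. Put $\mathcal S(D)=\bigcup_{x\in D}\big(x+\mathrm{supp}\,N(x,\cdot)\big)$, $\partial_SD=\partial D\cup(\mathcal S(D)\setminus D)$, $D_S=\partial_SD\cup D$ and $\bar u_{D_S}=\sup_{D_S}u$. Let $X_t(\omega)=\omega(t)$ be the canonical process on the space of càdlàg paths $[0,\infty)\to\mathbb R^d$, with natural filtration $(\mathcal F_t)$. Let $(P_x)_{x\in\mathbb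 R^d}$ be a strong Markovian solution of the martingale problem for $A$: a family of probability measures on the path space, measurable in $x$, such that $X$ has the strong Markov property with respect to $(\mathcal F_t)$ and $(P_x)$ and, for each Borel probability measure $\mu$ on $\mathbb R^d$, under $P_\mu=\int P_x\,\mu(dx)$ (in particular under each $P_x$) $X_0$ has law $\mu$ and, for every $f\in C_b^2(\mathbb R^d)$, the process $f(X_t)-f(X_0)-\int_0^tAf(X_r)\,dr$ is well defined a.s. and is an $(\mathcal F_t)$-martingale. Let $\tau_D=\inf\{t>0:X_t\notin D\}$ and assume $P_x(\tau_D<\infty)=1$ for all $x\in D$. For Borel $f\ge0$ put $R^D_1f(x)=\int_0^\infty e^{-t}\,\mathbb E_x[f(X_t),\,t<\tau_D]\,dt$. Let $m$ be a $\sigma$-finite Borel measure with $m(D)>0$. Condition IR$_m$) says: for every bounded Borel $f:D\to[0,\infty)$ with $\int_Df\,dm>0$ we have $R^D_1f(x)>0$ for all $x\in D$. Let $c:D\to[0,\infty)$ be bounded and Borel and put $e_c(t)=\exp\{-\int_0^tc(X_r)\,dr\}$. For a Borel function $g\le0$ on $D$, a bounded Borel function $u:\mathbb R^d\to\mathbb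 R$ is a weak subsolution of $(-A+c)v=g$ in $D$ if $$u(x)\le\mathbb E_x\big[e_c(\tau_D\wedge t)\,u(X_{\tau_D\wedge t})\big]+\mathbb E_x\Big[\int_0^{\tau_D\wedge t}e_c(r)g(X_r)\,dr\Big],\qquad x\in D,\ t\ge0.$$ **Theorem.** Assume IR$_m$). Then there is a Borel function $\psi:D\to(0,\infty)$, not depending on $g$ and $u$, with the following property: for every Borel $g\le0$ on $D$ and every weak subsolution $u$ of $(-A+c)v=g$ in $D$ that is not $m$-a.e. equal to a constant in $D$ and satisfies $\bar u_{D_S}\ge0$, there is $a>0$ such that $$\bar u_{D_S}-u(x)\ge a\,\psi(x),\qquad x\in D.$$ -/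

import Mathlib

open Set Filter Topology MeasureTheory ProbabilityTheory
open scoped NNReal ENNReal

noncomputable section

namespace HopfLemma

/-- The space `ℝ^d` with its Euclidean norm. -/
abbrev Rd (d : ℕ) : Type := EuclideanSpace ℝ (Fin d)

/-! ### The integro-differential operator -/

/-- The coefficients `Q`, `b` and the Levy kernel `N(x, dy)` of the operator `A`.
The kernel is written on the whole `ℝ^d`; a measure on `ℝ^d ∖ {0}` is a measure on `ℝ^d`
that does not charge the origin (see `IntegroDiffOp.Admissible`). -/
structure IntegroDiffOp (d : ℕ) where
  /-- the diffusion matrix -/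
  Q : Rd d → Matrix (Fin d) (Fin d) ℝ
  /-- the drift -/
  b : Rd d → Rd d
  /-- the Levy kernel -/
  N : Kernel (Rd d) (Rd d)

variable {d : ℕ}

/-- The standing assumptions on the coefficients: `Q`, `b` are Borel, bounded on `D`, `Q(x)` is
non-negative definite for `x ∈ D`, and
`sup_x ∫ min(1, |y|²) N(x, dy) < ∞`, where `N(x, ·)` lives on `ℝ^d ∖ {0}`. -/
structure IntegroDiffOp.Admissible (L : IntegroDiffOp d) (D : Set (Rd d)) : Prop where
  measurable_Q : ∀ i j, Measurable fun x => L.Q x i j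
  measurable_b : Measurable L.b
  bounded_Q : ∃ C : ℝ, ∀ x ∈ D, ∀ i j, |L.Q x i j| ≤ C
  bounded_b : ∃ C : ℝ, ∀ x ∈ D, ‖L.b x‖ ≤ C
  nonneg_Q : ∀ x ∈ D, ∀ ξ : Fin d → ℝ, 0 ≤ ∑ i, ∑ j, L.Q x i j * ξ i * ξ j
  N_zero : ∀ x, L.N x {0} = 0
  bounded_N : ∃ C : ℝ≥0, ∀ x, ∫⁻ y, ENNReal.ofReal (min 1 (‖y‖ ^ 2)) ∂(L.N x) ≤ C

/-- The matrix of second partial derivatives of `f` at `x`. -/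
def hessian (f : Rd d → ℝ) (x : Rd d) : Matrix (Fin d) (Fin d) ℝ :=
  Matrix.of fun i j =>
    fderiv ℝ (fderiv ℝ f) x (EuclideanSpace.single i 1) (EuclideanSpace.single j 1)

/-- `A f(x) = ½ Tr(Q(x) ∇²f(x)) + b(x)·∇f(x)
  + ∫ (f(x+y) - f(x) - y·∇f(x) / (1 + |y|²)) N(x, dy)`;
here `v·∇f(x)` is the derivative `fderiv ℝ f x v`. -/
def IntegroDiffOp.apply (L : IntegroDiffOp d) (f : Rd d → ℝ) (x : Rd d) : ℝ :=
  (1 / 2) * (L.Q x * hessian f x).trace + fderiv ℝ f x (L.b x)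
    + ∫ y, (f (x + y) - f x - fderiv ℝ f x y / (1 + ‖y‖ ^ 2)) ∂(L.N x)

/-- The range of non-locality `S_x = x + supp N(x, ·)`. -/
def IntegroDiffOp.nonlocalRangeAt (L : IntegroDiffOp d) (x : Rd d) : Set (Rd d) :=
  {z | ∃ y ∈ (L.N x).support, z = x + y}

/-- The range of non-locality `S(D) = ⋃_{x ∈ D} S_x`. -/
def IntegroDiffOp.nonlocalRange (L : IntegroDiffOp d) (D : Set (Rd d)) : Set (Rd d) :=
  ⋃ x ∈ D, L.nonlocalRangeAt x

/-- The extended boundary `∂_S D = ∂D ∪ (S(D) ∖ D)`. -/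
def IntegroDiffOp.extBoundary (L : IntegroDiffOp d) (D : Set (Rd d)) : Set (Rd d) :=
  frontier D ∪ (L.nonlocalRange D \ D)

/-- The set `D_S = ∂_S D ∪ D`. -/
def IntegroDiffOp.extDomain (L : IntegroDiffOp d) (D : Set (Rd d)) : Set (Rd d) :=
  L.extBoundary D ∪ D

/-- The class `C_b²(ℝ^d)`: twice continuously differentiable, bounded with the derivatives up to
order two. -/
def IsCb2 (f : Rd d → ℝ) : Prop :=
  ContDiff ℝ 2 f ∧ ∃ C : ℝ, ∀ x, |f x| ≤ C ∧ ‖fderiv ℝ f x‖ ≤ C ∧ ‖fderiv ℝ (fderiv ℝ f) x‖ ≤ C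

/-! ### The path space and the canonical process -/

/-- Cadlag paths `[0, ∞) → ℝ^d`. -/
structure CadlagPath (d : ℕ) where
  /-- the underlying function -/
  toFun : ℝ≥0 → Rd d
  right_cont : ∀ t, ContinuousWithinAt toFun (Ici t) t
  left_lim : ∀ t, ∃ l, Tendsto toFun (𝓝[<] t) (𝓝 l)

/-- The canonical process `X_t(ω) = ω(t)`. -/
def X (t : ℝ≥0) (ω : CadlagPath d) : Rd d := ω.toFun t

/-- The σ-algebra generated by the coordinates, i.e. the Borel σ-algebra of the Skorokhod
topology. -/
instance : MeasurableSpace (CadlagPath d) := ⨆ t : ℝ≥0, MeasurableSpace.comap (X t) inferInstance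

theorem measurable_X (t : ℝ≥0) : Measurable (X (d := d) t) :=
  Measurable.of_comap_le (le_iSup (fun t : ℝ≥0 =>
    MeasurableSpace.comap (X (d := d) t) inferInstance) t)

/-- The natural filtration `F_t = σ(X_s, s ≤ t)` of the canonical process. -/
def canonicalFiltration (d : ℕ) :
    Filtration ℝ≥0 (inferInstance : MeasurableSpace (CadlagPath d)) :=
  Filtration.natural (fun t => X (d := d) t) fun t => (measurable_X t).stronglyMeasurable

/-- The shift `θ_t(ω)(s) = ω(t + s)`. -/
def shift (t : ℝ≥0) (ω : CadlagPath d) : CadlagPath d where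
  toFun s := ω.toFun (t + s)
  right_cont s := by
    refine (ω.right_cont (t + s)).comp (t := Ici (t + s)) (by fun_prop) ?_
    intro r hr
    exact add_le_add_right (mem_Ici.mp hr) t
  left_lim s := by
    obtain ⟨l, hl⟩ := ω.left_lim (t + s)
    refine ⟨l, hl.comp ?_⟩
    refine tendsto_nhdsWithin_of_tendsto_nhds_of_eventually_within _ ?_ ?_
    · exact ((continuous_const.add continuous_id).tendsto s).mono_left nhdsWithin_le_nhds
    · filter_upwards [self_mem_nhdsWithin] with r hr
      exact add_lt_add_right (mem_Iio.mp hr) t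

/-! ### The martingale problem -/

/-- `M_t[f] = f(X_t) - f(X_0) - ∫_0^t A f(X_r) dr`. -/
def martingaleProcess (L : IntegroDiffOp d) (f : Rd d → ℝ) (t : ℝ≥0) (ω : CadlagPath d) : ℝ :=
  f (X t ω) - f (X 0 ω) - ∫ r in (0 : ℝ)..t, L.apply f (X r.toNNReal ω)

/-- `Pμ` solves the martingale problem for `A` with the initial distribution `μ`. The integrability
clause says that `M_t[f]` makes sense; it holds automatically when the coefficients are bounded on
the whole `ℝ^d`. -/
structure IsMartingaleSolution (L : IntegroDiffOp d) (μ : Measure (Rd d))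
    (Pμ : Measure (CadlagPath d)) : Prop where
  initial : Pμ.map (X 0) = μ
  integrable : ∀ f : Rd d → ℝ, IsCb2 f → ∀ t : ℝ≥0, ∀ᵐ ω ∂Pμ,
    IntervalIntegrable (fun r : ℝ => L.apply f (X r.toNNReal ω)) volume 0 t
  martingale : ∀ f : Rd d → ℝ, IsCb2 f →
    Martingale (martingaleProcess L f) (canonicalFiltration d) Pμ

/-- The strong Markov property of the canonical process under the family `(P_x)`, with respect to
its natural filtration: for every stopping time `T`, every `G ∈ F_T` with `G ⊆ {T < ∞}` and every
measurable set `B` of paths, `P_x(G ∩ {θ_T ∈ B}) = E_x[P_{X_T}(B), G]`. -/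
def IsStrongMarkovFamily (P : Kernel (Rd d) (CadlagPath d)) : Prop :=
  ∀ (x : Rd d) (T : CadlagPath d → WithTop ℝ≥0) (hT : IsStoppingTime (canonicalFiltration d) T)
    (G : Set (CadlagPath d)), MeasurableSet[hT.measurableSpace] G → (∀ ω ∈ G, T ω ≠ ⊤) →
    ∀ B : Set (CadlagPath d), MeasurableSet B →
      P x (G ∩ {ω | shift ((T ω).untopD 0) ω ∈ B})
        = ∫⁻ ω in G, P (X ((T ω).untopD 0) ω) B ∂(P x)

/-- A strong Markovian solution of the martingale problem: a family `(P_x)` of probability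
measures on the path space, measurable in `x`, with the strong Markov property, such that
`P_x` solves the martingale problem started at `x` and `∫ P_x μ(dx)` solves it started from `μ`. -/
structure IsStrongMarkovSolution (L : IntegroDiffOp d) (P : Kernel (Rd d) (CadlagPath d)) : Prop where
  isMarkovKernel : IsMarkovKernel P
  solution : ∀ x, IsMartingaleSolution L (Measure.dirac x) (P x)
  strongMarkov : IsStrongMarkovFamily P
  mixture : ∀ μ : Measure (Rd d), IsProbabilityMeasure μ → IsMartingaleSolution L μ (μ.bind P)

/-! ### Exit time, resolvent, irreducibility -/

/-- The exit time `τ_D = inf {t > 0 : X_t ∉ D}`, with `inf ∅ = ∞`. -/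
def exitTime (D : Set (Rd d)) (ω : CadlagPath d) : ℝ≥0∞ :=
  ⨅ (t : ℝ≥0) (_ : 0 < t ∧ X t ω ∉ D), (t : ℝ≥0∞)

/-- The (finite) time `τ_D ∧ t`. -/
def exitTimeMin (D : Set (Rd d)) (t : ℝ≥0) (ω : CadlagPath d) : ℝ≥0 :=
  (min (exitTime D ω) t).toNNReal

/-- `P_x(τ_D < ∞) = 1` for all `x ∈ D`. -/
def ExitTimeFinite (P : Kernel (Rd d) (CadlagPath d)) (D : Set (Rd d)) : Prop :=
  ∀ x ∈ D, ∀ᵐ ω ∂(P x), exitTime D ω < ⊤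

/-- `P_t^D f(x) = E_x[f(X_t), t < τ_D]` for `f ≥ 0`. -/
def killedSemigroup (P : Kernel (Rd d) (CadlagPath d)) (D : Set (Rd d)) (t : ℝ≥0) (f : Rd d → ℝ≥0)
    (x : Rd d) : ℝ≥0∞ :=
  ∫⁻ ω, {ω | (t : ℝ≥0∞) < exitTime D ω}.indicator (fun ω => (f (X t ω) : ℝ≥0∞)) ω ∂(P x)

/-- `R_α^D f(x) = ∫_0^∞ e^{-α t} P_t^D f(x) dt` for `f ≥ 0`. -/
def resolvent (P : Kernel (Rd d) (CadlagPath d)) (D : Set (Rd d)) (α : ℝ) (f : Rd d → ℝ≥0)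
    (x : Rd d) : ℝ≥0∞ :=
  ∫⁻ t in Ioi (0 : ℝ),
    ENNReal.ofReal (Real.exp (-α * t)) * killedSemigroup P D t.toNNReal f x

/-- The irreducibility condition: `R_1^D f > 0` everywhere on `D` for every non-negative bounded
Borel `f` with `∫_D f dm > 0`. Only the values of `f` in `D` matter. -/
def ResolventIrreducible (P : Kernel (Rd d) (CadlagPath d)) (D : Set (Rd d)) (m : Measure (Rd d)) :
    Prop :=
  ∀ f : Rd d → ℝ≥0, Measurable f → (∃ C : ℝ≥0, ∀ x, f x ≤ C) →
    0 < ∫⁻ x in D, (f x : ℝ≥0∞) ∂m → ∀ x ∈ D, 0 < resolvent P D 1 f x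

/-! ### Weak subsolutions -/

/-- `e_c(t) = exp(-∫_0^t c(X_r) dr)`. -/
def expFunctional (c : Rd d → ℝ) (t : ℝ≥0) (ω : CadlagPath d) : ℝ :=
  Real.exp (-∫ r in (0 : ℝ)..t, c (X r.toNNReal ω))

/-- `-E_x[∫_0^{τ_D ∧ t} e_c(r) g(X_r) dr]` for `g ≤ 0` on `D`, the integral of a non-negative
function, possibly `∞`. -/
def sourceTerm (P : Kernel (Rd d) (CadlagPath d)) (D : Set (Rd d)) (c g : Rd d → ℝ) (t : ℝ≥0)
    (x : Rd d) : ℝ≥0∞ :=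
  ∫⁻ ω, (∫⁻ r in Ioc (0 : ℝ) (exitTimeMin D t ω),
    ENNReal.ofReal (expFunctional c r.toNNReal ω * (-g (X r.toNNReal ω)))) ∂(P x)

/-- `u` is a weak subsolution of `(-A + c) v = g` in `D`, where `g ≤ 0` on `D`: it is bounded and
Borel on `ℝ^d`, and for all `x ∈ D`, `t ≥ 0`,
`u(x) ≤ E_x[e_c(τ_D ∧ t) u(X_{τ_D ∧ t})] + E_x[∫_0^{τ_D ∧ t} e_c(r) g(X_r) dr]`.
The last expectation may be `-∞`, and then the inequality fails. The values of `c` and `g`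
outside `D` play no role. -/
structure IsWeakSubsolution (P : Kernel (Rd d) (CadlagPath d)) (D : Set (Rd d))
    (c g u : Rd d → ℝ) : Prop where
  measurable : Measurable u
  bounded : ∃ C : ℝ, ∀ x, |u x| ≤ C
  le : ∀ x ∈ D, ∀ t : ℝ≥0,
    (u x : EReal) ≤
      ((∫ ω, expFunctional c (exitTimeMin D t ω) ω * u (X (exitTimeMin D t ω) ω) ∂(P x) : ℝ) :
          EReal)
        - (sourceTerm P D c g t x : EReal)

end HopfLemma

end

/-!
Write `M` for the supremum of `u` over `D_S` and `w = M - u`. Since `M ≥ 0` and the process is in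
`D_S` at the exit from `D`, the subsolution inequality gives `w(x) ≥ e^{-Ct} E_x[w(X_t), t < τ_D]`
with `C` a bound of `c`; integrated against `e^{-t} dt`, it says that `w` dominates `K w`, where `K`
is the resolvent kernel `R^D_{1+C}` (`IsWeakSubsolution.exp_mul_lintegral_le`,
`lintegral_occupationKernel_le_of_forall_exp_mul_le`). Irreducibility means that `m`
restricted to `D` is absolutely continuous with respect to every `K(x, ·)`, `x ∈ D`. As `u` is not
constant, it follows that `w > 0` on `D`.

The common lower bound comes from a uniform version of this absolute continuity
(`exists_common_minorant`). Replace `m` by a finite equivalent measure on `D`. There are `n` and a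
set `B ⊆ D` of positive measure such that for each `x ∈ B` the density of `m` with respect to
`K(x, ·)` is at most `n` off a set carrying less than a quarter of `m`. If `w ≥ η` off another such
set, then `w ≥ K w` is at least a positive constant on `B`, hence at least a multiple of
`ψ = K(·, B)` on `D`.

The position at the exit is found from the martingale problem alone, by optional stopping
(`integrable_and_integral_stopped`, `dynkin`). The exit time of an open set need not be Borel on the
path space, so it is compared with the contact time, at which the path or its left limit first
touches the complement of `D`; that is a stopping time of the natural filtration. Because `A f` is
bounded on `D`, the process does not jump back into `D` at a contact by its left limit
(`ae_X_contactTimeMin_notMem`), and the two times agree almost surely. A Borel set `U` away from the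
closure of `D` with `N(y, U - y) = 0` for all `y ∈ D` is not hit at the exit, since `A 1_U = 0` on
`D`; this is made rigorous by smooth approximations of indicators of compact sets
(`ae_X_contactTimeMin_notMem_of_jumps`). It applies to `U = {u > M}`.
-/

namespace HopfLemma

/-! ### Optional stopping in continuous time -/

section OptionalStopping

variable {Ω : Type*} {mΩ : MeasurableSpace Ω}

/-- The smallest multiple of `1 / (n + 1)` that is strictly larger than `t`. The strict inequality
makes `upperApprox n T` a stopping time whenever `T` is one: `{upperApprox n T ≤ i}` is `{T < j}`
for a grid point `j ≤ i`. -/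
noncomputable def upperApprox (n : ℕ) (t : ℝ≥0) : ℝ≥0 := (⌊(n + 1 : ℝ≥0) * t⌋₊ + 1 : ℝ≥0) / (n + 1)

theorem lt_upperApprox (n : ℕ) (t : ℝ≥0) : t < upperApprox n t := by
  rw [upperApprox, lt_div_iff₀ (by positivity), mul_comm]
  exact Nat.lt_floor_add_one _

theorem upperApprox_le (n : ℕ) (t : ℝ≥0) : upperApprox n t ≤ t + 1 / (n + 1 : ℝ≥0) := by
  rw [upperApprox, add_div]
  gcongr
  rw [div_le_iff₀ (by positivity), mul_comm]
  exact Nat.floor_le (by positivity)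

theorem tendsto_upperApprox (t : ℝ≥0) : Tendsto (fun n => upperApprox n t) atTop (𝓝[≥] t) := by
  refine tendsto_nhdsWithin_of_tendsto_nhds_of_eventually_within _ ?_
    (Eventually.of_forall fun n => (lt_upperApprox n t).le)
  refine tendsto_of_tendsto_of_tendsto_of_le_of_le tendsto_const_nhds ?_
    (fun n => (lt_upperApprox n t).le) (fun n => upperApprox_le n t)
  have h0 : Tendsto (fun n : ℕ => 1 / (n + 1 : ℝ≥0)) atTop (𝓝 0) := by
    rw [← NNReal.tendsto_coe]
    simpa using tendsto_one_div_add_atTop_nhds_zero_nat (𝕜 := ℝ)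
  simpa using (tendsto_const_nhds (x := t)).add h0

theorem upperApprox_le_iff (n : ℕ) (t i : ℝ≥0) :
    upperApprox n t ≤ i ↔ t < (⌊(n + 1 : ℝ≥0) * i⌋₊ : ℝ≥0) / (n + 1) := by
  rw [upperApprox, div_le_iff₀ (by positivity), lt_div_iff₀ (by positivity), mul_comm i,
    mul_comm t, ← Nat.floor_lt (by positivity), ← Nat.succ_le_iff,
    Nat.le_floor_iff (by positivity)]
  push_cast
  rfl

theorem countable_range_upperApprox (n : ℕ) : (range (upperApprox n)).Countable := by
  refine (countable_range fun k : ℕ => (k + 1 : ℝ≥0) / (n + 1)).mono ?_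
  rintro _ ⟨t, rfl⟩
  exact ⟨_, rfl⟩

theorem isStoppingTime_upperApprox {ℱ : Filtration ℝ≥0 mΩ} {T : Ω → ℝ≥0}
    (hT : IsStoppingTime ℱ fun ω => (T ω : WithTop ℝ≥0)) (n : ℕ) :
    IsStoppingTime ℱ fun ω => (upperApprox n (T ω) : WithTop ℝ≥0) := by
  intro i
  set j : ℝ≥0 := (⌊(n + 1 : ℝ≥0) * i⌋₊ : ℝ≥0) / (n + 1)
  have hj : j ≤ i := by
    rw [div_le_iff₀ (by positivity), mul_comm]
    exact Nat.floor_le (by positivity)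
  convert ℱ.mono hj _ (hT.measurableSet_lt j) using 1
  ext ω
  simp only [mem_ofPred_eq, WithTop.coe_le_coe, WithTop.coe_lt_coe]
  exact upperApprox_le_iff n _ _

/-- Optional stopping at a bounded time for a martingale with right-continuous paths. The values of
the martingale at the countably valued times `upperApprox n T ↓ T` are conditional expectations of
one integrable variable, so they converge in `L¹`. -/
theorem integrable_and_integral_stopped {ℱ : Filtration ℝ≥0 mΩ} {μ : Measure Ω}
    [IsProbabilityMeasure μ] {M : ℝ≥0 → Ω → ℝ} (hM : Martingale M ℱ μ) {T : Ω → ℝ≥0}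
    (hT : IsStoppingTime ℱ fun ω => (T ω : WithTop ℝ≥0)) {N : ℝ≥0} (hTN : ∀ ω, T ω ≤ N)
    (hcont : ∀ᵐ ω ∂μ, ∀ t ≤ N, ContinuousWithinAt (fun s => M s ω) (Ici t) t) :
    Integrable (fun ω => M (T ω) ω) μ ∧ ∫ ω, M (T ω) ω ∂μ = ∫ ω, M 0 ω ∂μ := by
  have hS := isStoppingTime_upperApprox hT
  have hle : ∀ n ω, (upperApprox n (T ω) : WithTop ℝ≥0) ≤ ((N + 1 : ℝ≥0) : WithTop ℝ≥0) := by
    intro n ω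
    rw [WithTop.coe_le_coe]
    refine (upperApprox_le n _).trans (add_le_add (hTN ω) ?_)
    rw [div_le_one (by positivity)]
    simp
  have hcount : ∀ n, (range fun ω => (upperApprox n (T ω) : WithTop ℝ≥0)).Countable := by
    intro n
    refine ((countable_range_upperApprox n).image (fun t : ℝ≥0 => (t : WithTop ℝ≥0))).mono ?_
    rintro _ ⟨ω, rfl⟩
    exact ⟨_, ⟨T ω, rfl⟩, rfl⟩
  have heq : ∀ n, (fun ω => M (upperApprox n (T ω)) ω) =ᵐ[μ]
      μ[M (N + 1) | (hS n).measurableSpace] := by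
    intro n
    have := hM.stoppedValue_ae_eq_condExp_of_le_const_of_countable_range (hS n) (hle n) (hcount n)
    exact this
  have hUI : UniformIntegrable (fun n ω => M (upperApprox n (T ω)) ω) 1 μ := by
    refine UniformIntegrable.ae_eq
      ((hM.integrable (N + 1)).uniformIntegrable_condExp (ι := ℕ)
        (ℱ := fun n => (hS n).measurableSpace) fun n => (hS n).measurableSpace_le)
      fun n => (heq n).symm
  have hlim : ∀ᵐ ω ∂μ, Tendsto (fun n => M (upperApprox n (T ω)) ω) atTop (𝓝 (M (T ω) ω)) := by
    filter_upwards [hcont] with ω hω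
    exact (hω (T ω) (hTN ω)).tendsto.comp (tendsto_upperApprox (T ω))
  have hint : Integrable (fun ω => M (T ω) ω) μ := hUI.integrable_of_ae_tendsto hlim
  refine ⟨hint, ?_⟩
  have h1 := tendsto_Lp_finite_of_tendsto_ae le_rfl ENNReal.one_ne_top
    (fun n => hUI.aestronglyMeasurable n) (memLp_one_iff_integrable.2 hint) hUI.unifIntegrable hlim
  have h2 := tendsto_integral_of_L1' _ hint.aestronglyMeasurable
    (Eventually.of_forall fun n => memLp_one_iff_integrable.1 (hUI.memLp n)) h1
  refine tendsto_nhds_unique h2 ?_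
  refine tendsto_const_nhds.congr fun n => ?_
  rw [integral_congr_ae (heq n), integral_condExp (hS n).measurableSpace_le]
  have := hM.setIntegral_eq (zero_le (a := N + 1)) (MeasurableSet.univ)
  simpa using this

end OptionalStopping

variable {d : ℕ}

/-! ### Contact times of cadlag paths -/

theorem tendsto_X_upperApprox (t : ℝ≥0) (ω : CadlagPath d) :
    Tendsto (fun n => X (upperApprox n t) ω) atTop (𝓝 (X t ω)) :=
  (ω.right_cont t).tendsto.comp (tendsto_upperApprox t)

theorem measurable_uncurry_X : Measurable fun p : ℝ≥0 × CadlagPath d => X p.1 p.2 := by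
  refine measurable_of_tendsto_metrizable (f := fun n (p : ℝ≥0 × CadlagPath d) =>
    X (upperApprox n p.1) p.2) (fun n => ?_)
    (tendsto_pi_nhds.2 fun p => tendsto_X_upperApprox p.1 p.2)
  have h1 : Measurable fun q : ℕ × CadlagPath d => X ((q.1 + 1 : ℝ≥0) / (n + 1)) q.2 :=
    measurable_from_prod_countable_right fun k =>
      measurable_X ((k + 1 : ℝ≥0) / (n + 1))
  have h2 : Measurable fun p : ℝ≥0 × CadlagPath d => (⌊(n + 1 : ℝ≥0) * p.1⌋₊, p.2) :=
    (Nat.measurable_floor.comp (measurable_const.mul measurable_fst)).prodMk measurable_snd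
  exact h1.comp h2

theorem measurable_X_stopped {T : CadlagPath d → ℝ≥0} (hT : Measurable T) :
    Measurable fun ω => X (T ω) ω :=
  measurable_uncurry_X.comp (hT.prodMk measurable_id)

/-- The times `t` such that `φ` along the path has infimum at most `ε` over `[0, t]`. -/
def contactSet (φ : Rd d → ℝ) (ε : ℝ) (ω : CadlagPath d) : Set ℝ≥0 :=
  {t | ∀ δ > ε, ∃ s ≤ t, φ (X s ω) < δ}

/-- The first time at which `φ(X)`, or its left limit, is at most `ε`. Unlike the hitting time of
`{φ ≤ ε}`, it is a stopping time of the natural filtration. -/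
noncomputable def contactTime (φ : Rd d → ℝ) (ε : ℝ) (ω : CadlagPath d) : ℝ≥0∞ :=
  ⨅ t ∈ contactSet φ ε ω, (t : ℝ≥0∞)

/-- The contact time capped at `t`. -/
noncomputable def contactTimeMin (φ : Rd d → ℝ) (ε : ℝ) (t : ℝ≥0) (ω : CadlagPath d) : ℝ≥0 :=
  (min (contactTime φ ε ω) t).toNNReal

theorem coe_contactTimeMin (φ : Rd d → ℝ) (ε : ℝ) (t : ℝ≥0) (ω : CadlagPath d) :
    (contactTimeMin φ ε t ω : ℝ≥0∞) = min (contactTime φ ε ω) t :=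
  ENNReal.coe_toNNReal (ne_top_of_le_ne_top ENNReal.coe_ne_top (min_le_right _ _))

theorem contactTime_le_iff {φ : Rd d → ℝ} (hφ : Continuous φ) {ε : ℝ} {ω : CadlagPath d}
    {t : ℝ≥0} : contactTime φ ε ω ≤ t ↔ t ∈ contactSet φ ε ω := by
  refine ⟨fun h δ hδ => ?_, fun h => iInf₂_le t h⟩
  by_contra! hcon
  have hgt : (ε + δ) / 2 < φ (X t ω) := by
    have := hcon t le_rfl
    linarith [show ε < δ from hδ]
  have hev : ∀ᶠ s in 𝓝[≥] t, (ε + δ) / 2 < φ (X s ω) :=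
    ((hφ.tendsto _).comp (ω.right_cont t).tendsto).eventually (lt_mem_nhds hgt)
  obtain ⟨t', ht', hsub⟩ := mem_nhdsGE_iff_exists_Ico_subset.1 hev
  have hlt : contactTime φ ε ω < t' := h.trans_lt (by exact_mod_cast ht')
  simp only [contactTime, iInf_lt_iff] at hlt
  obtain ⟨r, hr, hrt⟩ := hlt
  obtain ⟨s, hsr, hs⟩ := hr ((ε + δ) / 2) (by linarith [show ε < δ from hδ])
  rcases le_total s t with hst | hst
  · have := hcon s hst
    linarith [show ε < δ from hδ]
  · have hrt' : r < t' := by exact_mod_cast hrt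
    exact absurd (hsub ⟨hst, hsr.trans_lt hrt'⟩) (not_lt.2 hs.le)

theorem contactTimeMin_le_iff {φ : Rd d → ℝ} (hφ : Continuous φ) {ε : ℝ} {ω : CadlagPath d}
    {t i : ℝ≥0} : contactTimeMin φ ε t ω ≤ i ↔ t ≤ i ∨ i ∈ contactSet φ ε ω := by
  rw [← ENNReal.coe_le_coe, coe_contactTimeMin, min_le_iff,
    contactTime_le_iff hφ, or_comm, ENNReal.coe_le_coe]

theorem contactTimeMin_le (φ : Rd d → ℝ) (ε : ℝ) (t : ℝ≥0) (ω : CadlagPath d) :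
    contactTimeMin φ ε t ω ≤ t := by
  rw [← ENNReal.coe_le_coe, coe_contactTimeMin]
  exact min_le_right _ _

theorem measurableSet_mem_contactSet {φ : Rd d → ℝ} (hφ : Continuous φ) (ε : ℝ) (t : ℝ≥0) :
    MeasurableSet[canonicalFiltration d t] {ω : CadlagPath d | t ∈ contactSet φ ε ω} := by
  obtain ⟨Q, hQc, hQd⟩ := TopologicalSpace.exists_countable_dense ℝ≥0
  have key : {ω : CadlagPath d | t ∈ contactSet φ ε ω} =
      ⋂ n : ℕ, ({ω | φ (X t ω) < ε + 1 / (n + 1 : ℝ)} ∪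
        ⋃ q ∈ Q ∩ Iic t, {ω | φ (X q ω) < ε + 1 / (n + 1 : ℝ)}) := by
    ext ω
    simp only [mem_ofPred_eq, mem_iInter, mem_union, mem_iUnion, exists_prop]
    constructor
    · intro h n
      obtain ⟨s, hst, hs⟩ := h (ε + 1 / (n + 1 : ℝ)) (lt_add_of_pos_right _ (by positivity))
      rcases hst.eq_or_lt with rfl | hlt
      · exact Or.inl hs
      right
      have hev : ∀ᶠ r in 𝓝[≥] s, φ (X r ω) < ε + 1 / (n + 1 : ℝ) :=
        ((hφ.tendsto _).comp (ω.right_cont s).tendsto).eventually (gt_mem_nhds hs)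
      obtain ⟨s', hs', hsub⟩ := mem_nhdsGE_iff_exists_Ico_subset.1 hev
      obtain ⟨q, hqQ, hq⟩ := hQd.exists_mem_open (isOpen_Ioo (a := s) (b := min s' t))
        (nonempty_Ioo.2 (lt_min hs' hlt))
      exact ⟨q, ⟨hqQ, (hq.2.trans_le (min_le_right _ _)).le⟩,
        hsub ⟨hq.1.le, hq.2.trans_le (min_le_left _ _)⟩⟩
    · intro h δ hδ
      obtain ⟨n, hn⟩ := exists_nat_one_div_lt (sub_pos.2 (show ε < δ from hδ))
      rcases h n with h | ⟨q, ⟨_, hqt⟩, h⟩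
      · exact ⟨t, le_rfl, by linarith⟩
      · exact ⟨q, hqt, by linarith⟩
  have hX : ∀ s ≤ t, Measurable[canonicalFiltration d t] (X (d := d) s) := fun s hs =>
    Measurable.of_comap_le (le_iSup₂_of_le s hs le_rfl)
  rw [key]
  refine MeasurableSet.iInter fun n => MeasurableSet.union ?_
    (MeasurableSet.biUnion (hQc.mono inter_subset_left) fun q hq => ?_)
  · exact hX t le_rfl (hφ.measurable measurableSet_Iio)
  · exact hX q hq.2 (hφ.measurable measurableSet_Iio)

theorem isStoppingTime_contactTimeMin {φ : Rd d → ℝ} (hφ : Continuous φ) (ε : ℝ) (t : ℝ≥0) :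
    IsStoppingTime (canonicalFiltration d)
      fun ω => (contactTimeMin φ ε t ω : WithTop ℝ≥0) := by
  intro i
  simp only [WithTop.coe_le_coe, contactTimeMin_le_iff hφ]
  by_cases h : t ≤ i
  · simp [h]
  · simpa [h] using measurableSet_mem_contactSet hφ ε i

theorem measurable_contactTimeMin {φ : Rd d → ℝ} (hφ : Continuous φ) (ε : ℝ) (t : ℝ≥0) :
    Measurable (contactTimeMin (d := d) φ ε t) := by
  refine measurable_of_Iic fun i => ?_
  have := isStoppingTime_contactTimeMin (d := d) hφ ε t i
  simp only [WithTop.coe_le_coe] at this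
  exact (canonicalFiltration d).le i _ this

theorem measurable_contactTime {φ : Rd d → ℝ} (hφ : Continuous φ) (ε : ℝ) :
    Measurable (contactTime (d := d) φ ε) := by
  have : contactTime (d := d) φ ε = fun ω => ⨆ n : ℕ, (contactTimeMin φ ε n ω : ℝ≥0∞) := by
    ext ω
    have h : ∀ n : ℕ, (contactTimeMin φ ε n ω : ℝ≥0∞) = min (contactTime φ ε ω) n := fun n => by
      rw [coe_contactTimeMin]; simp
    simp only [h]
    rw [← inf_iSup_eq, ENNReal.iSup_natCast, inf_top_eq]
  rw [this]
  exact Measurable.iSup fun n => (measurable_contactTimeMin hφ ε n).coe_nnreal_ennreal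

theorem lt_of_lt_contactTime {φ : Rd d → ℝ} {ω : CadlagPath d} {s : ℝ≥0} {ε : ℝ}
    (h : (s : ℝ≥0∞) < contactTime φ ε ω) : ε < φ (X s ω) := by
  by_contra! hcon
  exact absurd h (not_lt.2 (iInf₂_le s fun δ hδ => ⟨s, le_rfl, hcon.trans_lt hδ⟩))

theorem lt_of_lt_contactTimeMin {φ : Rd d → ℝ} {ω : CadlagPath d} {s t : ℝ≥0} {ε : ℝ}
    (h : s < contactTimeMin φ ε t ω) : ε < φ (X s ω) := by
  refine lt_of_lt_contactTime (lt_of_lt_of_le (ENNReal.coe_lt_coe.2 h) ?_)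
  rw [coe_contactTimeMin]
  exact min_le_left _ _

theorem contactTime_anti (φ : Rd d → ℝ) (ω : CadlagPath d) {ε ε' : ℝ} (h : ε ≤ ε') :
    contactTime φ ε' ω ≤ contactTime φ ε ω :=
  iInf_le_iInf_of_subset fun _ ht δ hδ => ht δ (lt_of_le_of_lt h hδ)

theorem contactTimeMin_anti (φ : Rd d → ℝ) (ω : CadlagPath d) (t : ℝ≥0) {ε ε' : ℝ} (h : ε ≤ ε') :
    contactTimeMin φ ε' t ω ≤ contactTimeMin φ ε t ω := by
  refine ENNReal.toNNReal_mono
    (ne_top_of_le_ne_top ENNReal.coe_ne_top (min_le_right _ _))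
    (min_le_min_right _ (contactTime_anti φ ω h))

theorem contactTimeMin_of_lt {φ : Rd d → ℝ} {ω : CadlagPath d} {t : ℝ≥0} {ε : ℝ}
    (h : (t : ℝ≥0∞) < contactTime φ ε ω) : contactTimeMin φ ε t ω = t := by
  rw [contactTimeMin, min_eq_right h.le, ENNReal.toNNReal_coe]

/-- The contact times at the levels `1 / (n + 1)` exhaust the contact time at level `0`. -/
theorem eventually_lt_contactTime {φ : Rd d → ℝ} (hφ : Continuous φ) {ω : CadlagPath d} {t : ℝ≥0}
    (h : (t : ℝ≥0∞) < contactTime φ 0 ω) :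
    ∀ᶠ n : ℕ in atTop, (t : ℝ≥0∞) < contactTime φ (1 / (n + 1 : ℝ)) ω := by
  have ht : t ∉ contactSet φ 0 ω := fun hmem => absurd h (not_lt.2 (iInf₂_le t hmem))
  simp only [contactSet, mem_ofPred_eq, not_forall, not_exists, not_and, not_lt] at ht
  obtain ⟨δ, hδ, hall⟩ := ht
  obtain ⟨n, hn⟩ := exists_nat_one_div_lt (show (0 : ℝ) < δ from hδ)
  filter_upwards [eventually_ge_atTop n] with k hk
  rw [← not_le, contactTime_le_iff hφ]
  intro hmem
  obtain ⟨s, hst, hs⟩ := hmem δ (lt_of_le_of_lt (by gcongr) hn)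
  exact absurd hs (not_lt.2 (hall s hst))

theorem tendsto_contactTimeMin {φ : Rd d → ℝ} (hφ : Continuous φ) (ω : CadlagPath d) (t : ℝ≥0) :
    Tendsto (fun n : ℕ => contactTimeMin φ (1 / (n + 1 : ℝ)) t ω) atTop
      (𝓝 (contactTimeMin φ 0 t ω)) := by
  refine tendsto_order.2 ⟨fun a ha => ?_, fun a ha => Eventually.of_forall fun n =>
    (contactTimeMin_anti φ ω t (by positivity)).trans_lt ha⟩
  have h1 : (a : ℝ≥0∞) < contactTime φ 0 ω ∧ (a : ℝ≥0∞) < t := by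
    rw [← lt_min_iff, ← coe_contactTimeMin]
    exact_mod_cast ha
  filter_upwards [eventually_lt_contactTime hφ h1.1] with n hn
  rw [← ENNReal.coe_lt_coe, coe_contactTimeMin]
  exact lt_min hn h1.2

/-- Let `f` vanish where `φ < ε₀`. The values of `f` at the times of contact with `{φ ≤ 1 / (n+1)}`
tend to `0` on the event that contact with `{φ ≤ 0}` occurs by time `t`, also when this contact is
only one of the left limit of the path. -/
theorem tendsto_comp_X_contactTimeMin {φ : Rd d → ℝ} (hφ : Continuous φ) {f : Rd d → ℝ}
    (hf : Continuous f) {ε₀ : ℝ} (hε₀ : 0 < ε₀) (hsupp : ∀ y, φ y < ε₀ → f y = 0)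
    (ω : CadlagPath d) (t : ℝ≥0) :
    Tendsto (fun n : ℕ => f (X (contactTimeMin φ (1 / (n + 1 : ℝ)) t ω) ω)) atTop
      (𝓝 ({ω | (t : ℝ≥0∞) < contactTime φ 0 ω}.indicator (fun ω => f (X t ω)) ω)) := by
  by_cases hlt : (t : ℝ≥0∞) < contactTime φ 0 ω
  · rw [indicator_of_mem (by exact hlt)]
    refine tendsto_const_nhds.congr' ?_
    filter_upwards [eventually_lt_contactTime hφ hlt] with n hn
    rw [contactTimeMin_of_lt hn]
  rw [indicator_of_notMem (by exact hlt)]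
  set s : ℝ≥0 := contactTimeMin φ 0 t ω with hs
  have hsσ : (s : ℝ≥0∞) = contactTime φ 0 ω := by
    rw [hs, coe_contactTimeMin, min_eq_left (not_lt.1 hlt)]
  have hsmem : s ∈ contactSet φ 0 ω := (contactTime_le_iff hφ).1 hsσ.ge
  have hT := tendsto_contactTimeMin hφ ω t
  set T : ℕ → ℝ≥0 := fun n => contactTimeMin φ (1 / (n + 1 : ℝ)) t ω with hTdef
  have hTs : ∀ n, T n ≤ s := fun n => contactTimeMin_anti φ ω t (by positivity)
  by_cases hB : ∃ n₀, T n₀ = s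
  · obtain ⟨n₀, hn₀⟩ := hB
    have hfs : f (X s ω) = 0 := by
      refine hsupp _ ?_
      obtain ⟨r, hr, hφr⟩ := hsmem (min ε₀ (1 / (n₀ + 1 : ℝ))) (by positivity)
      rcases hr.eq_or_lt with rfl | hr
      · exact hφr.trans_le (min_le_left _ _)
      · have h1 := lt_of_lt_contactTimeMin (φ := φ) (ω := ω) (s := r) (hn₀ ▸ hr)
        exact absurd (hφr.trans_le (min_le_right _ _)) (not_lt.2 h1.le)
    refine tendsto_const_nhds.congr' ?_
    filter_upwards [eventually_ge_atTop n₀] with n hn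
    have : T n = s := le_antisymm (hTs n) (hn₀ ▸ contactTimeMin_anti φ ω t (by gcongr))
    change 0 = f (X (T n) ω)
    rw [this, hfs]
  push Not at hB
  have hTlt : ∀ n, T n < s := fun n => lt_of_le_of_ne (hTs n) (hB n)
  obtain ⟨l, hl⟩ := ω.left_lim s
  have hTlim : Tendsto T atTop (𝓝[<] s) :=
    tendsto_nhdsWithin_of_tendsto_nhds_of_eventually_within _ hT (Eventually.of_forall hTlt)
  have hTmem : ∀ n : ℕ, T n ∈ contactSet φ (1 / (n + 1 : ℝ)) ω := by
    intro n
    rcases (contactTimeMin_le_iff hφ).1 (le_refl (T n)) with h | h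
    · exact absurd (h.trans_lt (hTlt n)) (not_lt.2 (contactTimeMin_le φ 0 t ω))
    · exact h
  have hr : ∀ n : ℕ, ∃ r ≤ T n, φ (X r ω) < 2 * (1 / (n + 1 : ℝ)) := fun n =>
    hTmem n _ (by have : (0 : ℝ) < 1 / (n + 1 : ℝ) := by positivity
                  show 1 / (n + 1 : ℝ) < 2 * (1 / (n + 1 : ℝ))
                  linarith)
  choose r hrT hφr using hr
  have h0 : Tendsto (fun n : ℕ => 2 * (1 / (n + 1 : ℝ))) atTop (𝓝 0) := by
    simpa using (tendsto_one_div_add_atTop_nhds_zero_nat (𝕜 := ℝ)).const_mul 2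
  have hrlim : Tendsto r atTop (𝓝[<] s) := by
    refine tendsto_nhdsWithin_of_tendsto_nhds_of_eventually_within _ ?_
      (Eventually.of_forall fun n => (hrT n).trans_lt (hTlt n))
    refine tendsto_order.2 ⟨fun a ha => ?_, fun a ha => Eventually.of_forall fun n =>
      ((hrT n).trans (hTs n)).trans_lt ha⟩
    have ha' : a ∉ contactSet φ 0 ω := by
      rw [← contactTime_le_iff hφ, ← hsσ]
      exact not_le.2 (by exact_mod_cast ha)
    simp only [contactSet, mem_ofPred_eq, not_forall, not_exists, not_and, not_lt] at ha'
    obtain ⟨δ, hδ, hall⟩ := ha'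
    filter_upwards [h0.eventually (gt_mem_nhds hδ)] with n hn
    by_contra! hcon
    exact absurd ((hφr n).trans hn) (not_lt.2 (hall _ hcon))
  have hφl : φ l ≤ 0 :=
    le_of_tendsto_of_tendsto' ((hφ.tendsto l).comp (hl.comp hrlim)) h0 fun n => (hφr n).le
  have hfl : f l = 0 := hsupp l (hφl.trans_lt hε₀)
  rw [← hfl]
  exact (hf.tendsto l).comp (hl.comp hTlim)

/-- The exit time is the contact time if the path is outside `D` at the contact time. -/
theorem exitTime_eq_contactTime {φ : Rd d → ℝ} {D : Set (Rd d)}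
    (hD : ∀ y, y ∈ D ↔ 0 < φ y) {ω : CadlagPath d} (h0 : X 0 ω ∈ D)
    (hout : ∀ t : ℝ≥0, contactTime φ 0 ω ≤ t → X (contactTimeMin φ 0 t ω) ω ∉ D) :
    exitTime D ω = contactTime φ 0 ω := by
  refine le_antisymm ?_ (le_iInf₂ fun t ht => ?_)
  · rcases eq_or_ne (contactTime φ 0 ω) ⊤ with htop | hfin
    · exact htop ▸ le_top
    obtain ⟨s, hs⟩ : ∃ s : ℝ≥0, contactTime φ 0 ω = s := ⟨_, (ENNReal.coe_toNNReal hfin).symm⟩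
    have hmin : contactTimeMin φ 0 s ω = s := by
      rw [contactTimeMin, hs, min_self, ENNReal.toNNReal_coe]
    have hXs : X s ω ∉ D := hmin ▸ hout s hs.le
    have hspos : 0 < s := pos_iff_ne_zero.2 fun h => hXs (h ▸ h0)
    rw [hs]
    exact iInf₂_le s ⟨hspos, hXs⟩
  · by_contra! hlt
    exact ht.2 ((hD _).2 (lt_of_lt_contactTime hlt))

/-! ### Bounds for the operator and Dynkin's formula -/

theorem exists_bound_of_hasCompactSupport {E : Type*} [NormedAddCommGroup E] [NormedSpace ℝ E]
    {f : E → ℝ} (hf : ContDiff ℝ 2 f) (hc : HasCompactSupport f) :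
    ∃ C : ℝ, ∀ x, |f x| ≤ C ∧ ‖fderiv ℝ f x‖ ≤ C ∧ ‖fderiv ℝ (fderiv ℝ f) x‖ ≤ C := by
  have h1 : ContDiff ℝ 1 (fderiv ℝ f) := hf.fderiv_right (by norm_num)
  have h2 : Continuous (fderiv ℝ (fderiv ℝ f)) := h1.continuous_fderiv one_ne_zero
  have h2n : Continuous fun x => ‖fderiv ℝ (fderiv ℝ f) x‖ := by
    exact (continuous_norm (E := E →L[ℝ] E →L[ℝ] ℝ)).comp h2
  have h3 : Continuous fun x => max |f x| (max ‖fderiv ℝ f x‖ ‖fderiv ℝ (fderiv ℝ f) x‖) :=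
    hf.continuous.abs.max (h1.continuous.norm.max h2n)
  obtain ⟨C, hC⟩ := hc.isCompact.exists_bound_of_continuousOn h3.continuousOn
  refine ⟨max C 0, fun x => ?_⟩
  by_cases hx : x ∈ tsupport f
  · have h := (le_abs_self _).trans (hC x hx)
    simp only [max_le_iff] at h
    exact ⟨h.1.trans (le_max_left _ _), h.2.1.trans (le_max_left _ _), h.2.2.trans (le_max_left _ _)⟩
  · have hz : f =ᶠ[𝓝 x] fun _ => 0 := notMem_tsupport_iff_eventuallyEq.1 hx
    have hz1 : fderiv ℝ f =ᶠ[𝓝 x] 0 := by simpa using hz.fderiv (𝕜 := ℝ)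
    have hz2 : fderiv ℝ (fderiv ℝ f) x = 0 := by
      rw [hz1.fderiv_eq, fderiv_zero]; rfl
    rw [hz.eq_of_nhds, hz1.eq_of_nhds, hz2]
    exact ⟨by simp, by simp,
      (norm_zero (E := E →L[ℝ] E →L[ℝ] ℝ)).le.trans (le_max_right _ _)⟩

theorem isCb2_of_hasCompactSupport {f : Rd d → ℝ} (hf : ContDiff ℝ 2 f)
    (hc : HasCompactSupport f) : IsCb2 f :=
  ⟨hf, exists_bound_of_hasCompactSupport hf hc⟩

/-- The integrand of the non-local part is dominated by `min(1, |y|²)`. -/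
theorem abs_nonlocal_integrand_le {f : Rd d → ℝ} (hf : ContDiff ℝ 2 f) {C : ℝ}
    (hC : ∀ x, |f x| ≤ C ∧ ‖fderiv ℝ f x‖ ≤ C ∧ ‖fderiv ℝ (fderiv ℝ f) x‖ ≤ C) (x y : Rd d) :
    |f (x + y) - f x - fderiv ℝ f x y / (1 + ‖y‖ ^ 2)| ≤ 3 * C * min 1 (‖y‖ ^ 2) := by
  have hC0 : 0 ≤ C := (abs_nonneg _).trans (hC x).1
  have hdf : |fderiv ℝ f x y| ≤ C * ‖y‖ :=
    ((fderiv ℝ f x).le_opNorm y).trans (by gcongr; exact (hC x).2.1)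
  have hpos : 0 < 1 + ‖y‖ ^ 2 := by positivity
  rcases le_total ‖y‖ 1 with hy | hy
  · have hmin : min 1 (‖y‖ ^ 2) = ‖y‖ ^ 2 := min_eq_right (pow_le_one₀ (norm_nonneg _) hy)
    have h1 : Differentiable ℝ (fderiv ℝ f) :=
      (hf.fderiv_right (m := 1) (by norm_num)).differentiable (by norm_num)
    have hlip : ∀ z ∈ Metric.closedBall x ‖y‖, ‖fderiv ℝ f z - fderiv ℝ f x‖ ≤ C * ‖y‖ := by
      intro z hz
      refine (convex_univ.norm_image_sub_le_of_norm_fderiv_le (fun w _ => h1 w)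
        (fun w _ => (hC w).2.2) (mem_univ x) (mem_univ z)).trans ?_
      gcongr
      exact mem_closedBall_iff_norm.1 hz
    have htaylor := (convex_closedBall x ‖y‖).norm_image_sub_le_of_norm_fderiv_le'
      (fun w _ => (hf.differentiable (by norm_num)) w) hlip
      (Metric.mem_closedBall_self (norm_nonneg y)) (y := x + y) (by simp)
    rw [add_sub_cancel_left, Real.norm_eq_abs] at htaylor
    have hrew : f (x + y) - f x - fderiv ℝ f x y / (1 + ‖y‖ ^ 2) =
        (f (x + y) - f x - fderiv ℝ f x y)
          + fderiv ℝ f x y * (‖y‖ ^ 2 / (1 + ‖y‖ ^ 2)) := by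
      field_simp
      ring
    have hsmall : |fderiv ℝ f x y * (‖y‖ ^ 2 / (1 + ‖y‖ ^ 2))| ≤ C * ‖y‖ ^ 2 := by
      rw [abs_mul, abs_of_nonneg (by positivity : 0 ≤ ‖y‖ ^ 2 / (1 + ‖y‖ ^ 2))]
      have h2 : ‖y‖ ^ 2 / (1 + ‖y‖ ^ 2) ≤ ‖y‖ ^ 2 :=
        div_le_self (by positivity) (by nlinarith [sq_nonneg ‖y‖])
      have h3 : |fderiv ℝ f x y| ≤ C := hdf.trans (mul_le_of_le_one_right hC0 hy)
      exact mul_le_mul h3 h2 (by positivity) hC0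
    rw [hrew, hmin]
    refine (abs_add_le _ _).trans ?_
    nlinarith [sq_nonneg ‖y‖]
  · have hmin : min 1 (‖y‖ ^ 2) = 1 := min_eq_left (one_le_pow₀ hy)
    have hquot : |fderiv ℝ f x y / (1 + ‖y‖ ^ 2)| ≤ C := by
      rw [abs_div, abs_of_pos hpos, div_le_iff₀ hpos]
      refine hdf.trans ?_
      gcongr
      nlinarith
    rw [hmin]
    have h1 := abs_le.1 (hC (x + y)).1
    have h2 := abs_le.1 (hC x).1
    have h3 := abs_le.1 hquot
    rw [abs_le]
    constructor <;> linarith [h1.1, h1.2, h2.1, h2.2, h3.1, h3.2]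

theorem abs_integral_le_of_abs_le_min {L : IntegroDiffOp d} {CN : ℝ≥0} {x : Rd d}
    (hN : ∫⁻ y, ENNReal.ofReal (min 1 (‖y‖ ^ 2)) ∂(L.N x) ≤ CN) {h : Rd d → ℝ} {C : ℝ}
    (hC : 0 ≤ C) (hh : ∀ y, |h y| ≤ C * min 1 (‖y‖ ^ 2)) :
    |∫ y, h y ∂(L.N x)| ≤ C * CN := by
  refine (norm_integral_le_lintegral_norm h).trans ?_
  refine ENNReal.toReal_le_of_le_ofReal (by positivity) ?_
  calc ∫⁻ y, ENNReal.ofReal ‖h y‖ ∂(L.N x)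
      ≤ ∫⁻ y, ENNReal.ofReal C * ENNReal.ofReal (min 1 (‖y‖ ^ 2)) ∂(L.N x) := by
        refine lintegral_mono fun y => ?_
        rw [← ENNReal.ofReal_mul hC]
        exact ENNReal.ofReal_le_ofReal (hh y)
    _ = ENNReal.ofReal C * ∫⁻ y, ENNReal.ofReal (min 1 (‖y‖ ^ 2)) ∂(L.N x) :=
        lintegral_const_mul' _ _ ENNReal.ofReal_ne_top
    _ ≤ ENNReal.ofReal C * CN := by gcongr
    _ = ENNReal.ofReal (C * CN) := by
        rw [ENNReal.ofReal_mul hC, ENNReal.ofReal_coe_nnreal]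

theorem IntegroDiffOp.Admissible.exists_abs_apply_le {L : IntegroDiffOp d} {D : Set (Rd d)}
    (hL : L.Admissible D) {f : Rd d → ℝ} (hf : IsCb2 f) :
    ∃ C : ℝ, ∀ x ∈ D, |L.apply f x| ≤ C := by
  obtain ⟨hf2, C, hC⟩ := hf
  have hC0 : 0 ≤ C := (abs_nonneg _).trans (hC 0).1
  obtain ⟨CQ, hCQ⟩ := hL.bounded_Q
  obtain ⟨Cb, hCb⟩ := hL.bounded_b
  obtain ⟨CN, hCN⟩ := hL.bounded_N
  refine ⟨1 / 2 * ∑ _i : Fin d, ∑ _j : Fin d, CQ * C + C * Cb + 3 * C * CN, fun x hx => ?_⟩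
  have hhess : ∀ i j, |hessian f x i j| ≤ C := by
    intro i j
    have h1 := ((fderiv ℝ (fderiv ℝ f) x) (EuclideanSpace.single i 1)).le_opNorm
      (EuclideanSpace.single j (1 : ℝ))
    have h2 := (fderiv ℝ (fderiv ℝ f) x).le_opNorm (EuclideanSpace.single i (1 : ℝ))
    simp only [PiLp.norm_single, norm_one, mul_one] at h1 h2
    exact h1.trans (h2.trans (hC x).2.2)
  have htrace : |(L.Q x * hessian f x).trace| ≤ ∑ _i : Fin d, ∑ _j : Fin d, CQ * C := by
    simp only [Matrix.trace, Matrix.diag, Matrix.mul_apply]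
    refine (Finset.abs_sum_le_sum_abs _ _).trans (Finset.sum_le_sum fun i _ => ?_)
    refine (Finset.abs_sum_le_sum_abs _ _).trans (Finset.sum_le_sum fun j _ => ?_)
    rw [abs_mul]
    exact mul_le_mul (hCQ x hx i j) (hhess j i) (abs_nonneg _)
      ((abs_nonneg _).trans (hCQ x hx i j))
  have hdrift : |fderiv ℝ f x (L.b x)| ≤ C * Cb :=
    ((fderiv ℝ f x).le_opNorm _).trans
      (mul_le_mul (hC x).2.1 (hCb x hx) (norm_nonneg _) hC0)
  have hjump := abs_integral_le_of_abs_le_min (hCN x) (by positivity : 0 ≤ 3 * C)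
    (abs_nonlocal_integrand_le hf2 hC x)
  rw [IntegroDiffOp.apply]
  refine (abs_add_three _ _ _).trans ?_
  rw [abs_mul, abs_of_pos (by norm_num : (0 : ℝ) < 1 / 2)]
  gcongr

theorem ae_X_zero_eq {L : IntegroDiffOp d} {x : Rd d} {μ : Measure (CadlagPath d)}
    (hμ : IsMartingaleSolution L (Measure.dirac x) μ) : ∀ᵐ ω ∂μ, X 0 ω = x := by
  have h : ∀ᵐ y ∂(μ.map (X 0)), y = x := by
    rw [hμ.initial]
    exact (ae_dirac_iff (p := fun y => y = x) (measurableSet_singleton x)).2 rfl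
  exact ae_of_ae_map (measurable_X 0).aemeasurable h

/-- Dynkin's formula: the martingale property at a bounded stopping time. -/
theorem dynkin {L : IntegroDiffOp d} {x : Rd d} {μ : Measure (CadlagPath d)}
    [IsProbabilityMeasure μ] (hμ : IsMartingaleSolution L (Measure.dirac x) μ)
    {f : Rd d → ℝ} (hf : IsCb2 f) {T : CadlagPath d → ℝ≥0} (hTm : Measurable T)
    (hT : IsStoppingTime (canonicalFiltration d) fun ω => (T ω : WithTop ℝ≥0)) {N : ℝ≥0}
    (hTN : ∀ ω, T ω ≤ N) :
    AEStronglyMeasurable (fun ω => ∫ r in (0 : ℝ)..T ω, L.apply f (X r.toNNReal ω)) μ ∧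
      ∫ ω, f (X (T ω) ω) ∂μ
        = f x + ∫ ω, (∫ r in (0 : ℝ)..T ω, L.apply f (X r.toNNReal ω)) ∂μ := by
  obtain ⟨hf2, C, hC⟩ := hf
  have hfint : Integrable (fun ω => f (X (T ω) ω)) μ := by
    refine Integrable.of_bound (C := C) ?_ (Eventually.of_forall fun ω => (hC _).1)
    exact (hf2.continuous.measurable.comp (measurable_X_stopped hTm)).aestronglyMeasurable
  have h0int : Integrable (fun ω => f (X 0 ω)) μ := by
    refine Integrable.of_bound (C := C) ?_ (Eventually.of_forall fun ω => (hC _).1)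
    exact (hf2.continuous.measurable.comp (measurable_X 0)).aestronglyMeasurable
  have hcont : ∀ᵐ ω ∂μ, ∀ t ≤ N,
      ContinuousWithinAt (fun s => martingaleProcess L f s ω) (Ici t) t := by
    filter_upwards [hμ.integrable f ⟨hf2, C, hC⟩ (N + 1)] with ω hω t ht
    refine (((hf2.continuous.continuousAt.comp_continuousWithinAt (ω.right_cont t)).sub
      continuousWithinAt_const)).sub ?_
    have h1 := intervalIntegral.continuousOn_primitive_interval' hω left_mem_uIcc
    have h2 : ContinuousAt (fun s : ℝ≥0 => ((s : ℝ) : ℝ)) t := NNReal.continuous_coe.continuousAt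
    have h3 : ∀ s ∈ Iio (N + 1), ((s : ℝ≥0) : ℝ) ∈ uIcc (0 : ℝ) ((N + 1 : ℝ≥0) : ℝ) := by
      intro s hs
      rw [uIcc_of_le (by positivity)]
      exact ⟨s.2, NNReal.coe_le_coe.2 (le_of_lt hs)⟩
    have htN : t ∈ Iio (N + 1) := ht.trans_lt (lt_add_one N)
    have h4 : ContinuousWithinAt
        (fun s : ℝ≥0 => ∫ r in (0 : ℝ)..s, L.apply f (X r.toNNReal ω)) (Iio (N + 1)) t :=
      (h1 _ (h3 t htN)).comp h2.continuousWithinAt h3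
    exact (h4.continuousAt (Iio_mem_nhds htN)).continuousWithinAt
  obtain ⟨hMint, hMeq⟩ := integrable_and_integral_stopped
    (hμ.martingale f ⟨hf2, C, hC⟩) hT hTN hcont
  have hA : (fun ω => ∫ r in (0 : ℝ)..T ω, L.apply f (X r.toNNReal ω)) =
      fun ω => f (X (T ω) ω) - f (X 0 ω) - martingaleProcess L f (T ω) ω := by
    ext ω
    simp [martingaleProcess]
  have h0 : ∫ ω, f (X 0 ω) ∂μ = f x := by
    have : (fun ω => f (X 0 ω)) =ᵐ[μ] fun _ => f x := by
      filter_upwards [ae_X_zero_eq hμ] with ω hω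
      rw [hω]
    rw [integral_congr_ae this]
    simp
  have hM0 : ∫ ω, martingaleProcess L f 0 ω ∂μ = 0 := by
    simp [martingaleProcess]
  refine ⟨?_, ?_⟩
  · rw [hA]
    exact ((hfint.sub h0int).sub hMint).aestronglyMeasurable
  · have h1 := integral_sub (hfint.sub h0int) hMint
    have h2 := integral_sub hfint h0int
    simp only [Pi.sub_apply] at h1
    rw [hA, h1, h2, hMeq, h0, hM0]
    ring

/-! ### The position of the process at the exit time -/

theorem ae_mem_of_le_contactTimeMin {φ : Rd d → ℝ} {D : Set (Rd d)} (hD : ∀ y, y ∈ D ↔ 0 < φ y)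
    {ω : CadlagPath d} {s t : ℝ≥0} (hs : s ≤ contactTimeMin φ 0 t ω) :
    ∀ᵐ r : ℝ, r ∈ uIoc (0 : ℝ) s → X r.toNNReal ω ∈ D := by
  have hne : ∀ᵐ r : ℝ, r ≠ s := by simp [ae_iff]
  filter_upwards [hne] with r hr hmem
  rw [uIoc_of_le s.coe_nonneg] at hmem
  refine (hD _).2 (lt_of_lt_contactTimeMin (t := t) (lt_of_lt_of_le ?_ hs))
  rw [Real.toNNReal_lt_iff_lt_coe hmem.1.le]
  exact lt_of_le_of_ne hmem.2 hr

theorem abs_integral_path_le {φ : Rd d → ℝ} {D : Set (Rd d)} (hD : ∀ y, y ∈ D ↔ 0 < φ y)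
    {ω : CadlagPath d} {s t : ℝ≥0} (hs : s ≤ contactTimeMin φ 0 t ω) {F : Rd d → ℝ} {C : ℝ}
    (hC0 : 0 ≤ C) (hC : ∀ y ∈ D, |F y| ≤ C) :
    ‖∫ r in (0 : ℝ)..s, F (X r.toNNReal ω)‖ ≤ C * t := by
  refine (intervalIntegral.norm_integral_le_of_norm_le_const_ae
    (C := C) ((ae_mem_of_le_contactTimeMin hD hs).mono fun r hr hmem => hC _ (hr hmem))).trans ?_
  rw [sub_zero, abs_of_nonneg s.coe_nonneg]
  gcongr
  exact hs.trans (contactTimeMin_le φ 0 t ω)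

/-- At a contact with the complement of `D`, the value of a compactly supported function in `D` is
the limit of its values at the previous approximate contacts, in the mean. This is the
quasi-left-continuity of the process, and it holds because `A f` is bounded in `D`. -/
theorem integral_comp_X_contactTimeMin {L : IntegroDiffOp d} {D : Set (Rd d)}
    (hL : L.Admissible D) {φ : Rd d → ℝ} (hφ : Continuous φ) (hD : ∀ y, y ∈ D ↔ 0 < φ y)
    {x : Rd d} {μ : Measure (CadlagPath d)} [IsProbabilityMeasure μ]
    (hμ : IsMartingaleSolution L (Measure.dirac x) μ) {f : Rd d → ℝ} (hf : ContDiff ℝ 2 f)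
    (hfc : HasCompactSupport f) (hfD : tsupport f ⊆ D) (t : ℝ≥0) :
    ∫ ω, f (X (contactTimeMin φ 0 t ω) ω) ∂μ =
      ∫ ω, {ω | (t : ℝ≥0∞) < contactTime φ 0 ω}.indicator (fun ω => f (X t ω)) ω ∂μ := by
  have hfb := isCb2_of_hasCompactSupport hf hfc
  obtain ⟨C, hC⟩ := hL.exists_abs_apply_le hfb
  obtain ⟨ε₀, hε₀, hsupp⟩ := hfc.isCompact.exists_forall_le' (f := φ) (a := 0) hφ.continuousOn
    fun y hy => (hD y).1 (hfD hy)
  have hsupp' : ∀ y, φ y < ε₀ → f y = 0 := fun y hy =>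
    image_eq_zero_of_notMem_tsupport fun hmem => absurd hy (not_lt.2 (hsupp y hmem))
  set T : ℕ → CadlagPath d → ℝ≥0 := fun n => contactTimeMin φ (1 / (n + 1 : ℝ)) t
  have hdyn : ∀ ε : ℝ, _ := fun ε => dynkin hμ hfb (measurable_contactTimeMin hφ ε t)
    (isStoppingTime_contactTimeMin hφ ε t) (fun ω => contactTimeMin_le φ ε t ω)
  have hlim1 : Tendsto (fun n => ∫ ω, f (X (T n ω) ω) ∂μ) atTop
      (𝓝 (∫ ω, {ω | (t : ℝ≥0∞) < contactTime φ 0 ω}.indicator (fun ω => f (X t ω)) ω ∂μ)) := by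
    obtain ⟨Cf, hCf⟩ := hfb.2
    refine tendsto_integral_of_dominated_convergence (fun _ => Cf) (fun n => ?_)
      (integrable_const _) (fun n => Eventually.of_forall fun ω => (hCf _).1)
      (Eventually.of_forall fun ω => tendsto_comp_X_contactTimeMin hφ hf.continuous hε₀ hsupp' ω t)
    exact (hf.continuous.measurable.comp
      (measurable_X_stopped (measurable_contactTimeMin hφ _ t))).aestronglyMeasurable
  have hlim2 : Tendsto (fun n => ∫ ω, (∫ r in (0 : ℝ)..T n ω, L.apply f (X r.toNNReal ω)) ∂μ) atTop
      (𝓝 (∫ ω, (∫ r in (0 : ℝ)..contactTimeMin φ 0 t ω, L.apply f (X r.toNNReal ω)) ∂μ)) := by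
    refine tendsto_integral_of_dominated_convergence (fun _ => max C 0 * t)
      (fun n => (hdyn _).1) (integrable_const _)
      (fun n => Eventually.of_forall fun ω => abs_integral_path_le hD
        (contactTimeMin_anti φ ω t (by positivity)) (le_max_right _ _)
        fun y hy => (hC y hy).trans (le_max_left _ _)) ?_
    filter_upwards [hμ.integrable f hfb t] with ω hω
    have hmem : ∀ ε : ℝ, (contactTimeMin φ ε t ω : ℝ) ∈ uIcc (0 : ℝ) t := fun ε => by
      rw [uIcc_of_le t.coe_nonneg]
      exact ⟨NNReal.coe_nonneg _, NNReal.coe_le_coe.2 (contactTimeMin_le φ ε t ω)⟩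
    refine (intervalIntegral.continuousOn_primitive_interval' hω left_mem_uIcc _
      (hmem 0)).tendsto.comp (tendsto_nhdsWithin_of_tendsto_nhds_of_eventually_within _ ?_
        (Eventually.of_forall fun n => hmem _))
    exact (NNReal.continuous_coe.tendsto _).comp (tendsto_contactTimeMin hφ ω t)
  have hlim3 := (tendsto_const_nhds (x := f x)).add hlim2
  rw [← (hdyn 0).2] at hlim3
  exact tendsto_nhds_unique (hlim3.congr fun n => (hdyn _).2.symm) hlim1

/-- At the time of contact with the complement of `D` the process is outside `D`. -/
theorem ae_X_contactTimeMin_notMem {L : IntegroDiffOp d} {D : Set (Rd d)} (hDo : IsOpen D)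
    (hL : L.Admissible D) {φ : Rd d → ℝ} (hφ : Continuous φ) (hD : ∀ y, y ∈ D ↔ 0 < φ y)
    {x : Rd d} {μ : Measure (CadlagPath d)} [IsProbabilityMeasure μ]
    (hμ : IsMartingaleSolution L (Measure.dirac x) μ) :
    ∀ᵐ ω ∂μ, ∀ t : ℝ≥0, contactTime φ 0 ω ≤ t → X (contactTimeMin φ 0 t ω) ω ∉ D := by
  have hbump : ∀ y ∈ D, ∃ f : Rd d → ℝ, tsupport f ⊆ D ∧ HasCompactSupport f ∧ ContDiff ℝ 2 f ∧
      range f ⊆ Icc 0 1 ∧ f y = 1 := fun y hy => by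
    have := exists_contDiff_tsupport_subset (n := 2) (hDo.mem_nhds hy)
    exact_mod_cast this
  choose! f hfD hfc hf hfr hf1 using hbump
  obtain ⟨S, hSD, hSc, hcover⟩ := TopologicalSpace.countable_cover_nhdsWithin
    (f := fun y => Function.support (f y)) (s := D) fun y hy => mem_nhdsWithin_of_mem_nhds
      ((hf y hy).continuous.isOpen_support.mem_nhds (by simp [hf1 y hy]))
  have key : ∀ y ∈ S, ∀ n : ℕ, ∀ᵐ ω ∂μ, contactTime φ 0 ω ≤ (n : ℝ≥0) →
      f y (X (contactTimeMin φ 0 n ω) ω) = 0 := by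
    intro y hy n
    have hyD := hSD hy
    have h01 : ∀ z, f y z ∈ Icc (0 : ℝ) 1 := fun z => hfr y hyD (mem_range_self z)
    have hb : ∀ z, ‖f y z‖ ≤ 1 := fun z => by
      rw [Real.norm_eq_abs, abs_of_nonneg (h01 z).1]
      exact (h01 z).2
    have heq := integral_comp_X_contactTimeMin hL hφ hD hμ (hf y hyD) (hfc y hyD) (hfD y hyD)
      (n : ℝ≥0)
    have hm1 : Measurable fun ω => f y (X (contactTimeMin φ 0 n ω) ω) :=
      (hf y hyD).continuous.measurable.comp
        (measurable_X_stopped (measurable_contactTimeMin hφ 0 n))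
    have hset : MeasurableSet {ω : CadlagPath d | ((n : ℝ≥0) : ℝ≥0∞) < contactTime φ 0 ω} :=
      measurableSet_lt measurable_const (measurable_contactTime hφ 0)
    have hi1 : Integrable (fun ω => f y (X (contactTimeMin φ 0 n ω) ω)) μ :=
      Integrable.of_bound hm1.aestronglyMeasurable 1 (Eventually.of_forall fun ω => hb _)
    have hi2 : Integrable ({ω : CadlagPath d | ((n : ℝ≥0) : ℝ≥0∞) < contactTime φ 0 ω}.indicator
        fun ω => f y (X n ω)) μ :=
      (Integrable.of_bound ((hf y hyD).continuous.measurable.comp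
        (measurable_X n)).aestronglyMeasurable 1 (Eventually.of_forall fun ω => hb _)).indicator
        hset
    have hnonneg : ∀ ω, 0 ≤ f y (X (contactTimeMin φ 0 n ω) ω) -
        {ω : CadlagPath d | ((n : ℝ≥0) : ℝ≥0∞) < contactTime φ 0 ω}.indicator
          (fun ω => f y (X n ω)) ω := by
      intro ω
      by_cases hω : ((n : ℝ≥0) : ℝ≥0∞) < contactTime φ 0 ω
      · rw [indicator_of_mem (by exact hω), contactTimeMin_of_lt hω, sub_self]
      · rw [indicator_of_notMem (by exact hω), sub_zero]
        exact (h01 _).1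
    have hzero := (integral_eq_zero_iff_of_nonneg hnonneg (hi1.sub hi2)).1
      (by rw [integral_sub hi1 hi2, heq, sub_self])
    filter_upwards [hzero] with ω hω hle
    simp only [Pi.zero_apply] at hω
    rwa [indicator_of_notMem (by exact not_lt.2 hle), sub_zero] at hω
  have hall : ∀ᵐ ω ∂μ, ∀ y ∈ S, ∀ n : ℕ, contactTime φ 0 ω ≤ (n : ℝ≥0) →
      f y (X (contactTimeMin φ 0 n ω) ω) = 0 :=
    (ae_ball_iff hSc).2 fun y hy => ae_all_iff.2 (key y hy)
  filter_upwards [hall] with ω hω t ht hmem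
  obtain ⟨n, hn⟩ := exists_nat_ge t
  have htn : contactTime φ 0 ω ≤ (n : ℝ≥0) := ht.trans (ENNReal.coe_le_coe.2 hn)
  have hsame : contactTimeMin φ 0 t ω = contactTimeMin φ 0 n ω := by
    rw [contactTimeMin, contactTimeMin, min_eq_left ht, min_eq_left htn]
  obtain ⟨y, hyS, hy⟩ := mem_iUnion₂.1 (hcover hmem)
  exact hy (hsame ▸ hω y hyS n htn)

theorem IntegroDiffOp.apply_eq_of_eqOn_zero {L : IntegroDiffOp d} {D : Set (Rd d)}
    (hDo : IsOpen D) {f : Rd d → ℝ} (hf : ∀ y ∈ D, f y = 0) {y : Rd d} (hy : y ∈ D) :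
    L.apply f y = ∫ z, f (y + z) ∂(L.N y) := by
  have h0 : f =ᶠ[𝓝 y] 0 := by
    filter_upwards [hDo.mem_nhds hy] with z hz using hf z hz
  have h1 : fderiv ℝ f =ᶠ[𝓝 y] 0 := by simpa using h0.fderiv (𝕜 := ℝ)
  have h2 : fderiv ℝ f y = 0 := h1.eq_of_nhds
  have h3 : fderiv ℝ (fderiv ℝ f) y = 0 := by
    rw [h1.fderiv_eq, fderiv_zero]; rfl
  have h4 : hessian f y = 0 := by
    ext i j
    simp [hessian, h3]
  simp [IntegroDiffOp.apply, h4, h2, hf y hy]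

/-- Up to the exit the process charges no set away from `D` that is not charged by the jumps
from `D`. Functions `fₙ ↓ 1_K`, with `K` compact in such a set `U`, vanish in `D`, so that
`A fₙ(y) = ∫ fₙ(y + z) N(y, dz)` for `y ∈ D`, and this tends to `N(y, K - y) = 0`. -/
theorem ae_X_contactTimeMin_notMem_of_jumps {L : IntegroDiffOp d} {D : Set (Rd d)}
    (hDo : IsOpen D) (hL : L.Admissible D) {φ : Rd d → ℝ} (hφ : Continuous φ)
    (hD : ∀ y, y ∈ D ↔ 0 < φ y) {x : Rd d} (hx : x ∈ D) {μ : Measure (CadlagPath d)}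
    [IsProbabilityMeasure μ] (hμ : IsMartingaleSolution L (Measure.dirac x) μ) {U : Set (Rd d)}
    (hU : MeasurableSet U) (hUD : Disjoint U (closure D))
    (hUN : ∀ y ∈ D, ∀ᵐ z ∂(L.N y), y + z ∉ U) (t : ℝ≥0) :
    ∀ᵐ ω ∂μ, X (contactTimeMin φ 0 t ω) ω ∉ U := by
  set T : CadlagPath d → ℝ≥0 := contactTimeMin φ 0 t with hTdef
  have hTm : Measurable T := measurable_contactTimeMin hφ 0 t
  have hXT : Measurable fun ω => X (T ω) ω := measurable_X_stopped hTm
  suffices hK : ∀ K ⊆ U, IsCompact K → μ {ω | X (T ω) ω ∈ K} = 0 by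
    have : μ.map (fun ω => X (T ω) ω) U = 0 := by
      rw [hU.measure_eq_iSup_isCompact]
      simp only [ENNReal.iSup_eq_zero]
      intro K hKU hKc
      rw [Measure.map_apply hXT hKc.measurableSet]
      exact hK K hKU hKc
    rw [Measure.map_apply hXT hU] at this
    exact (measure_eq_zero_iff_ae_notMem (s := (fun ω => X (T ω) ω) ⁻¹' U)).1 this
  intro K hKU hKc
  have hKD : K ⊆ (closure D)ᶜ := fun y hy hyD => disjoint_left.1 hUD (hKU hy) hyD
  obtain ⟨δ, hδ, hthick⟩ := hKc.exists_thickening_subset_open isClosed_closure.isOpen_compl hKD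
  set V : ℕ → Set (Rd d) := fun n => Metric.thickening (δ / (n + 2)) K with hV
  have hδn : ∀ n : ℕ, 0 < δ / (n + 2 : ℝ) := fun n => by positivity
  have hfn : ∀ n : ℕ, ∃ f : Rd d → ℝ, ContDiff ℝ 2 f ∧ (∀ y ∉ V n, f y = 0) ∧
      (∀ y ∈ K, f y = 1) ∧ ∀ y, f y ∈ Icc (0 : ℝ) 1 := by
    intro n
    obtain ⟨f, hf0, hf1, hf⟩ := exists_contMDiffMap_zero_one_of_isClosed
      (modelWithCornersSelf ℝ (Rd d)) (n := 2) (s := (V n)ᶜ) (t := K)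
      Metric.isOpen_thickening.isClosed_compl hKc.isClosed
      (disjoint_compl_left_iff_subset.2 (Metric.self_subset_thickening (hδn n) K))
    exact ⟨f, by exact_mod_cast f.contMDiff.contDiff, fun y hy => hf0 hy, fun y hy => hf1 hy, hf⟩
  choose f hf2 hf0 hf1 hf01 using hfn
  have hVhalf : ∀ n, V n ⊆ Metric.thickening (δ / 2) K := fun n =>
    Metric.thickening_mono (by gcongr; simp) K
  have hfcomp : ∀ n, HasCompactSupport (f n) := fun n =>
    HasCompactSupport.of_support_subset_isCompact (hKc.cthickening (r := δ / (n + 2)))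
      fun y hy => Metric.thickening_subset_cthickening _ _ (by_contra fun h => hy (hf0 n y h))
  have hfb : ∀ n, IsCb2 (f n) := fun n => isCb2_of_hasCompactSupport (hf2 n) (hfcomp n)
  -- a jump from `D` into the support of `fₙ` has length at least `δ / 2`
  have hjump : ∀ n, ∀ y ∈ D, ∀ z, f n (y + z) ≠ 0 → δ / 2 ≤ ‖z‖ := by
    intro n y hy z hz
    by_contra! hlt
    have h1 : y + z ∈ Metric.thickening (δ / 2) K := hVhalf n (by_contra fun h => hz (hf0 n _ h))
    obtain ⟨k, hk, hdist⟩ := Metric.mem_thickening_iff.1 h1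
    have h2 : y ∈ Metric.thickening δ K := by
      refine Metric.mem_thickening_iff.2 ⟨k, hk, ?_⟩
      have h3 : dist y (y + z) = ‖z‖ := by simp
      linarith [dist_triangle y (y + z) k]
    exact hthick h2 (subset_closure hy)
  have hfD : ∀ n, ∀ y ∈ D, f n y = 0 := by
    intro n y hy
    by_contra hne
    have := hjump n y hy 0 (by simpa using hne)
    rw [norm_zero] at this
    linarith
  set C0 : ℝ := 1 + 4 / δ ^ 2 with hC0
  have hC0pos : 0 ≤ C0 := by positivity
  have hdom : ∀ n, ∀ y ∈ D, ∀ z, |f n (y + z)| ≤ C0 * min 1 (‖z‖ ^ 2) := by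
    intro n y hy z
    by_cases hz : f n (y + z) = 0
    · rw [hz, abs_zero]
      positivity
    · have h1 : |f n (y + z)| ≤ 1 := by
        rw [abs_of_nonneg (hf01 n _).1]
        exact (hf01 n _).2
      have h2 := hjump n y hy z hz
      refine h1.trans ?_
      rcases le_total 1 (‖z‖ ^ 2) with h | h
      · rw [min_eq_left h, mul_one, hC0]
        have : 0 ≤ 4 / δ ^ 2 := by positivity
        linarith
      · rw [min_eq_right h, hC0, add_mul, div_mul_eq_mul_div]
        have h3 : 1 ≤ 4 * ‖z‖ ^ 2 / δ ^ 2 := by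
          rw [one_le_div (by positivity)]
          nlinarith
        nlinarith [sq_nonneg ‖z‖]
  obtain ⟨CN, hCN⟩ := hL.bounded_N
  have happly : ∀ n, ∀ y ∈ D, L.apply (f n) y = ∫ z, f n (y + z) ∂(L.N y) := fun n y hy =>
    IntegroDiffOp.apply_eq_of_eqOn_zero hDo (hfD n) hy
  have hbound : ∀ n, ∀ y ∈ D, |L.apply (f n) y| ≤ C0 * CN := by
    intro n y hy
    rw [happly n y hy]
    exact abs_integral_le_of_abs_le_min (hCN y) hC0pos (hdom n y hy)
  have happly_lim : ∀ y ∈ D, Tendsto (fun n => L.apply (f n) y) atTop (𝓝 0) := by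
    intro y hy
    simp only [happly _ y hy]
    rw [← integral_zero (Rd d) ℝ (μ := L.N y)]
    refine tendsto_integral_of_dominated_convergence (fun z => C0 * min 1 (‖z‖ ^ 2))
      (fun n => ?_) ?_ (fun n => Eventually.of_forall fun z => hdom n y hy z) ?_
    · exact ((hf2 n).continuous.comp (continuous_const.add continuous_id)).aestronglyMeasurable
    · refine Integrable.const_mul ⟨?_, ?_⟩ C0
      · exact (continuous_const.min (continuous_norm.pow 2)).aestronglyMeasurable
      · rw [hasFiniteIntegral_iff_ofReal (Eventually.of_forall fun z => by positivity)]
        exact (hCN y).trans_lt ENNReal.coe_lt_top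
    · filter_upwards [hUN y hy] with z hz
      have hnK : y + z ∉ K := fun h => hz (hKU h)
      rcases K.eq_empty_or_nonempty with hemp | hne
      · refine tendsto_const_nhds.congr fun n => (hf0 n _ ?_).symm
        simp [hV, hemp]
      have hpos : 0 < Metric.infDist (y + z) K :=
        (hKc.isClosed.notMem_iff_infDist_pos hne).1 hnK
      have hlim : Tendsto (fun n : ℕ => δ / (n + 2 : ℝ)) atTop (𝓝 0) := by
        refine tendsto_const_nhds.div_atTop ?_
        exact tendsto_atTop_add_const_right _ _ tendsto_natCast_atTop_atTop
      refine tendsto_const_nhds.congr' ?_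
      filter_upwards [hlim.eventually (gt_mem_nhds hpos)] with n hn
      refine (hf0 n _ fun hmem => ?_).symm
      obtain ⟨k, hk, hdist⟩ := Metric.mem_thickening_iff.1 hmem
      exact absurd (Metric.infDist_le_dist_of_mem hk) (not_le.2 (hdist.trans hn))
  have hdyn : ∀ n, _ := fun n => dynkin hμ (hfb n) hTm (isStoppingTime_contactTimeMin hφ 0 t)
    (fun ω => contactTimeMin_le φ 0 t ω)
  have hlim : Tendsto (fun n => ∫ ω, f n (X (T ω) ω) ∂μ) atTop (𝓝 0) := by
    simp only [fun n => (hdyn n).2, hfD _ x hx, zero_add]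
    suffices Tendsto (fun n => ∫ ω, (∫ r in (0 : ℝ)..T ω, L.apply (f n) (X r.toNNReal ω)) ∂μ) atTop
        (𝓝 (∫ _ω, (0 : ℝ) ∂μ)) by simpa only [integral_zero] using this
    refine tendsto_integral_of_dominated_convergence (fun _ => C0 * CN * t)
      (fun n => (hdyn n).1) (integrable_const _) (fun n => Eventually.of_forall fun ω =>
        abs_integral_path_le hD le_rfl (by positivity) (hbound n)) ?_
    filter_upwards [ae_all_iff.2 fun n => hμ.integrable (f n) (hfb n) t] with ω hω
    suffices Tendsto (fun n => ∫ r in (0 : ℝ)..T ω, L.apply (f n) (X r.toNNReal ω)) atTop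
        (𝓝 (∫ _r in (0 : ℝ)..T ω, (0 : ℝ))) by
      simpa only [intervalIntegral.integral_zero] using this
    refine intervalIntegral.tendsto_integral_filter_of_dominated_convergence (fun _ => C0 * CN)
      (Eventually.of_forall fun n => ?_) (Eventually.of_forall fun n => ?_)
      intervalIntegrable_const ?_
    · refine ((hω n).def'.mono_set (uIoc_subset_uIoc_of_uIcc_subset_uIcc ?_)).aestronglyMeasurable
      rw [uIcc_of_le (T ω).coe_nonneg, uIcc_of_le t.coe_nonneg]
      exact Icc_subset_Icc le_rfl (NNReal.coe_le_coe.2 (contactTimeMin_le φ 0 t ω))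
    · filter_upwards [ae_mem_of_le_contactTimeMin hD (le_refl (T ω))] with r hr hmem
      exact hbound n _ (hr hmem)
    · filter_upwards [ae_mem_of_le_contactTimeMin hD (le_refl (T ω))] with r hr hmem
      exact happly_lim _ (hr hmem)
  have hKmeas : MeasurableSet {ω | X (T ω) ω ∈ K} := hXT hKc.measurableSet
  have hle : ∀ n, μ.real {ω | X (T ω) ω ∈ K} ≤ ∫ ω, f n (X (T ω) ω) ∂μ := by
    intro n
    rw [← integral_indicator_one hKmeas]
    refine integral_mono_of_nonneg (Eventually.of_forall fun ω => ?_) ?_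
      (Eventually.of_forall fun ω => ?_)
    · exact indicator_nonneg (fun _ _ => zero_le_one) _
    · refine Integrable.of_bound ((hf2 n).continuous.measurable.comp hXT).aestronglyMeasurable 1
        (Eventually.of_forall fun ω => ?_)
      rw [Real.norm_eq_abs, abs_of_nonneg (hf01 n _).1]
      exact (hf01 n _).2
    · by_cases h : X (T ω) ω ∈ K
      · simp [indicator_of_mem (show ω ∈ {ω | X (T ω) ω ∈ K} from h), hf1 n _ h]
      · rw [indicator_of_notMem (by exact h)]
        exact (hf01 n _).1
  have h0 : μ.real {ω | X (T ω) ω ∈ K} ≤ 0 := ge_of_tendsto' hlim hle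
  exact (measureReal_eq_zero_iff (by finiteness)).1 (le_antisymm h0 measureReal_nonneg)

/-! ### A minorant for excessive functions -/

section Minorant

variable {E : Type*} [MeasurableSpace E] [MeasurableSpace.CountablyGenerated E]

/-- Let every `K x` with `x ∈ D` dominate the measure `m`. Then the functions `w ≥ K w` that are
positive on `D` share, up to a constant factor, one lower bound, of the form `x ↦ K x B`.
The set `B` is chosen such that the density of `m` with respect to `K x` is, uniformly in `x ∈ B`,
bounded on a set carrying most of `m`. -/
theorem exists_common_minorant (K : Kernel E E) [IsFiniteKernel K] {D : Set E}
    (hD : MeasurableSet D) (m : Measure E) [IsFiniteMeasure m] (hm0 : m ≠ 0) (hmD : m Dᶜ = 0)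
    (hac : ∀ x ∈ D, m ≪ K x) :
    ∃ B : Set E, MeasurableSet B ∧ (∀ x ∈ D, 0 < K x B) ∧
      ∀ w : E → ℝ≥0∞, Measurable w → (∀ x ∈ D, 0 < w x) →
        (∀ x ∈ D, ∫⁻ y, w y ∂(K x) ≤ w x) →
        ∃ a : ℝ≥0∞, 0 < a ∧ a ≠ ⊤ ∧ ∀ x ∈ D, a * K x B ≤ w x := by
  have hmpos : 0 < m univ := by simpa [pos_iff_ne_zero] using hm0
  have hmtop : m univ ≠ ⊤ := measure_ne_top m univ
  set h : E → E → ℝ≥0∞ := fun x y => (Kernel.const E m).rnDeriv K x y with hh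
  have hmeas : Measurable fun p : E × E => h p.1 p.2 := Kernel.measurable_rnDeriv _ _
  have hdens : ∀ x ∈ D, m = (K x).withDensity (h x) := by
    intro x hx
    have := Kernel.withDensity_rnDeriv_eq (κ := Kernel.const E m) (η := K) (a := x)
      (by simpa using hac x hx)
    rw [Kernel.withDensity_apply _ (Kernel.measurable_rnDeriv _ _)] at this
    simpa using this.symm
  -- the sets on which the density is bounded, and the points for which they carry most of `m`
  set A : ℕ → E → Set E := fun n x => {y | h x y ≤ n}
  have hAm : ∀ n x, MeasurableSet (A n x) := fun n x =>
    measurableSet_le (hmeas.comp measurable_prodMk_left) measurable_const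
  set C : ℕ → Set E := fun n => D ∩ {x | m (A n x)ᶜ < m univ / 4}
  have hCm : ∀ n, MeasurableSet (C n) := by
    intro n
    refine hD.inter (measurableSet_lt ?_ measurable_const)
    have : MeasurableSet {p : E × E | h p.1 p.2 ≤ n}ᶜ :=
      (measurableSet_le hmeas measurable_const).compl
    exact measurable_measure_prodMk_left this
  have hquarter : 0 < m univ / 4 := ENNReal.div_pos hmpos.ne' (by norm_num)
  have hcover : D ⊆ ⋃ n, C n := by
    intro x hx
    have hfin : ∀ᵐ y ∂m, h x y < ⊤ := by
      have h1 : ∀ᵐ y ∂(K x), h x y < ⊤ := Kernel.rnDeriv_lt_top (Kernel.const E m) K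
      exact (hac x hx).ae_le h1
    have hlim : Tendsto (fun n => m (A n x)ᶜ) atTop (𝓝 (m (⋂ n, (A n x)ᶜ))) := by
      refine tendsto_measure_iInter_atTop (fun n => (hAm n x).compl.nullMeasurableSet) ?_
        ⟨0, measure_ne_top _ _⟩
      intro i j hij
      refine compl_subset_compl.2 fun y hy => ?_
      exact le_trans (show h x y ≤ i from hy) (by exact_mod_cast hij)
    have hzero : m (⋂ n, (A n x)ᶜ) = 0 := by
      refine measure_mono_null ?_ hfin
      intro y hy
      simp only [mem_iInter, mem_compl_iff] at hy
      intro hlt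
      obtain ⟨n, hn⟩ := ENNReal.exists_nat_gt (show h x y ≠ ⊤ from ne_of_lt hlt)
      exact hy n hn.le
    rw [hzero] at hlim
    obtain ⟨n, hn⟩ := (hlim.eventually (gt_mem_nhds hquarter)).exists
    exact mem_iUnion.2 ⟨n, hx, hn⟩
  obtain ⟨n, hn⟩ : ∃ n, 0 < m (C n) := by
    by_contra! hcon
    have h0 : m (⋃ n, C n) = 0 := measure_iUnion_null fun n => le_antisymm (hcon n) zero_le
    have : m univ = 0 := by
      rw [← union_compl_self D]
      exact measure_union_null (measure_mono_null hcover h0) hmD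
    exact hmpos.ne' this
  refine ⟨C n, hCm n, fun x hx => ?_, fun w hw hwpos hKw => ?_⟩
  · exact pos_iff_ne_zero.2 fun h0 => hn.ne' (hac x hx h0)
  -- a level `η` below which `w` stays only on a small set
  obtain ⟨k, hk⟩ : ∃ k : ℕ, m {y | w y < (k + 1 : ℝ≥0∞)⁻¹} < m univ / 4 := by
    have hlim : Tendsto (fun k : ℕ => m {y | w y < (k + 1 : ℝ≥0∞)⁻¹}) atTop
        (𝓝 (m (⋂ k : ℕ, {y | w y < (k + 1 : ℝ≥0∞)⁻¹}))) := by
      refine tendsto_measure_iInter_atTop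
        (fun k => (measurableSet_lt hw measurable_const).nullMeasurableSet) ?_
        ⟨0, measure_ne_top _ _⟩
      intro i j hij y hy
      refine lt_of_lt_of_le (show w y < (j + 1 : ℝ≥0∞)⁻¹ from hy) ?_
      gcongr
    have hzero : m (⋂ k : ℕ, {y | w y < (k + 1 : ℝ≥0∞)⁻¹}) = 0 := by
      refine measure_mono_null ?_ hmD
      intro y hy hyD
      simp only [mem_iInter, mem_ofPred_eq] at hy
      obtain ⟨k, hk⟩ := ENNReal.exists_inv_nat_lt (hwpos y hyD).ne'
      refine lt_irrefl _ ((hy k).trans (lt_of_le_of_lt ?_ hk))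
      gcongr
      exact le_self_add
    rw [hzero] at hlim
    exact (hlim.eventually (gt_mem_nhds hquarter)).exists
  set η : ℝ≥0∞ := (k + 1 : ℝ≥0∞)⁻¹ with hη
  have hηpos : 0 < η := ENNReal.inv_pos.2 (by finiteness)
  have hηtop : η ≠ ⊤ := ENNReal.inv_ne_top.2 (by simp)
  set a : ℝ≥0∞ := η * ((n + 1 : ℝ≥0∞)⁻¹ * (m univ / 4))
  have ha : 0 < a := by
    refine ENNReal.mul_pos hηpos.ne' (ENNReal.mul_pos ?_ hquarter.ne').ne'
    exact (ENNReal.inv_pos.2 (by finiteness)).ne'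
  have haC : ∀ x ∈ C n, a ≤ w x := by
    intro x hx
    set G : Set E := {y | η ≤ w y} ∩ A n x
    have hG : MeasurableSet G := (measurableSet_le measurable_const hw).inter (hAm n x)
    have hGc : m Gᶜ ≤ m univ / 4 + m univ / 4 := by
      rw [compl_inter]
      refine (measure_union_le _ _).trans (add_le_add (le_trans (measure_mono ?_) hk.le) hx.2.le)
      intro y hy
      exact not_le.1 (show ¬ η ≤ w y from hy)
    have hGm : m univ / 4 ≤ m G := by
      have h1 : m univ ≤ m G + m Gᶜ := by
        rw [← union_compl_self G]
        exact measure_union_le _ _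
      by_contra! hcon
      have h2 : m univ < m univ / 4 + (m univ / 4 + m univ / 4) :=
        h1.trans_lt (ENNReal.add_lt_add_of_lt_of_le (by finiteness) hcon hGc)
      have h3 : m univ / 4 + (m univ / 4 + m univ / 4) ≤ m univ := by
        have : m univ / 4 + (m univ / 4 + m univ / 4) = m univ * (3 / 4) := by
          rw [ENNReal.div_eq_inv_mul, ENNReal.div_eq_inv_mul]; ring
        rw [this]
        refine mul_le_of_le_one_right' ?_
        refine ENNReal.div_le_of_le_mul ?_
        norm_num
      exact absurd h2 (not_lt.2 h3)
    have hKG : (n + 1 : ℝ≥0∞)⁻¹ * (m univ / 4) ≤ K x G := by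
      rw [ENNReal.inv_mul_le_iff (by simp) (by finiteness)]
      calc m univ / 4 ≤ m G := hGm
        _ = ∫⁻ y in G, h x y ∂(K x) := by
          conv_lhs => rw [hdens x hx.1]
          rw [withDensity_apply _ hG]
        _ ≤ ∫⁻ y in G, (n + 1 : ℝ≥0∞) ∂(K x) := by
          refine setLIntegral_mono' hG fun y hy => ?_
          exact le_trans hy.2 le_self_add
        _ = (n + 1 : ℝ≥0∞) * K x G := by rw [setLIntegral_const]
    calc a ≤ η * K x G := mul_le_mul' le_rfl hKG
      _ = ∫⁻ y in G, η ∂(K x) := by rw [setLIntegral_const]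
      _ ≤ ∫⁻ y in G, w y ∂(K x) := setLIntegral_mono' hG fun y hy => hy.1
      _ ≤ ∫⁻ y, w y ∂(K x) := setLIntegral_le_lintegral _ _
      _ ≤ w x := hKw x hx.1
  refine ⟨a, ha, by finiteness, fun x hx => ?_⟩
  calc a * K x (C n) = ∫⁻ y in C n, a ∂(K x) := by rw [setLIntegral_const]
    _ ≤ ∫⁻ y in C n, w y ∂(K x) := setLIntegral_mono' (hCm n) haC
    _ ≤ ∫⁻ y, w y ∂(K x) := setLIntegral_le_lintegral _ _
    _ ≤ w x := hKw x hx

end Minorant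

/-! ### The killed occupation kernel -/

/-- The pairs of a time and a path that has not reached `{φ ≤ 0}` by that time. -/
def beforeContact (φ : Rd d → ℝ) : Set (ℝ × CadlagPath d) :=
  {p | (p.1.toNNReal : ℝ≥0∞) < contactTime φ 0 p.2}

theorem measurableSet_beforeContact {φ : Rd d → ℝ} (hφ : Continuous φ) :
    MeasurableSet (beforeContact φ) :=
  measurableSet_lt (measurable_real_toNNReal.comp measurable_fst).coe_nnreal_ennreal
    ((measurable_contactTime hφ 0).comp measurable_snd)

theorem measurable_X_real : Measurable fun p : ℝ × CadlagPath d => X p.1.toNNReal p.2 :=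
  measurable_uncurry_X.comp ((measurable_real_toNNReal.comp measurable_fst).prodMk measurable_snd)

/-- The measure `e^{-αt} dt` on `(0, ∞)`. -/
noncomputable def expMeasure (α : ℝ) : Measure ℝ :=
  (volume.restrict (Ioi 0)).withDensity fun t => ENNReal.ofReal (Real.exp (-α * t))

theorem measurable_expDensity (α : ℝ) :
    Measurable fun t : ℝ => ENNReal.ofReal (Real.exp (-α * t)) := by
  fun_prop

theorem isFiniteMeasure_expMeasure {α : ℝ} (hα : 0 < α) : IsFiniteMeasure (expMeasure α) :=
  isFiniteMeasure_withDensity_ofReal (exp_neg_integrableOn_Ioi 0 hα).2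

instance (α : ℝ) : SFinite (expMeasure α) := by
  unfold expMeasure
  infer_instance

/-- The kernel `x ↦ E_x ∫_0^∞ e^{-αt} 1_{t < σ} 1_{X_t ∈ ·} dt`, where `σ` is the time of contact
with `{φ ≤ 0}`. For the distance `φ` to the complement of `D` it is the resolvent of the process
killed outside `D`; the contact time replaces the exit time, which is in general measurable only
after completion. -/
noncomputable def occupationKernel (P : Kernel (Rd d) (CadlagPath d)) {φ : Rd d → ℝ}
    (hφ : Continuous φ) (α : ℝ) : Kernel (Rd d) (Rd d) :=
  (((Kernel.const (Rd d) (expMeasure α)) ×ₖ P).restrict (measurableSet_beforeContact hφ)).map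
    fun p => X p.1.toNNReal p.2

theorem isFiniteKernel_occupationKernel (P : Kernel (Rd d) (CadlagPath d)) [IsMarkovKernel P]
    {φ : Rd d → ℝ} (hφ : Continuous φ) {α : ℝ} (hα : 0 < α) :
    IsFiniteKernel (occupationKernel P hφ α) := by
  have := isFiniteMeasure_expMeasure hα
  unfold occupationKernel
  infer_instance

theorem measurable_lintegral_beforeContact (μ : Measure (CadlagPath d)) [SFinite μ]
    {φ : Rd d → ℝ} (hφ : Continuous φ) {f : Rd d → ℝ≥0∞} (hf : Measurable f) :
    Measurable fun t : ℝ => ∫⁻ ω, {ω | (t.toNNReal : ℝ≥0∞) < contactTime φ 0 ω}.indicator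
      (fun ω => f (X t.toNNReal ω)) ω ∂μ := by
  have h : Measurable ((beforeContact φ).indicator
      fun p : ℝ × CadlagPath d => f (X p.1.toNNReal p.2)) :=
    (hf.comp measurable_X_real).indicator (measurableSet_beforeContact hφ)
  exact h.lintegral_prod_right'

theorem lintegral_occupationKernel (P : Kernel (Rd d) (CadlagPath d)) [IsMarkovKernel P]
    {φ : Rd d → ℝ} (hφ : Continuous φ) (α : ℝ) {f : Rd d → ℝ≥0∞} (hf : Measurable f) (x : Rd d) :
    ∫⁻ y, f y ∂(occupationKernel P hφ α x) = ∫⁻ t in Ioi (0 : ℝ),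
      ENNReal.ofReal (Real.exp (-α * t)) *
        ∫⁻ ω, {ω | (t.toNNReal : ℝ≥0∞) < contactTime φ 0 ω}.indicator
          (fun ω => f (X t.toNNReal ω)) ω ∂(P x) := by
  have h : Measurable ((beforeContact φ).indicator
      fun p : ℝ × CadlagPath d => f (X p.1.toNNReal p.2)) :=
    (hf.comp measurable_X_real).indicator (measurableSet_beforeContact hφ)
  rw [occupationKernel, Kernel.map_apply _ measurable_X_real, lintegral_map hf measurable_X_real,
    Kernel.restrict_apply, Kernel.prod_apply, Kernel.const_apply,
    ← lintegral_indicator (measurableSet_beforeContact hφ), lintegral_prod _ h.aemeasurable,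
    expMeasure, lintegral_withDensity_eq_lintegral_mul _ (measurable_expDensity α)
      h.lintegral_prod_right']
  rfl

/-- Irreducibility of the resolvent says that the occupation kernel dominates `m` on `D`, for each
`α`. -/
theorem restrict_absolutelyContinuous_occupationKernel {P : Kernel (Rd d) (CadlagPath d)}
    [IsMarkovKernel P] {D : Set (Rd d)} {m : Measure (Rd d)}
    (hIR : ResolventIrreducible P D m) {φ : Rd d → ℝ} (hφ : Continuous φ) (α : ℝ) {x : Rd d}
    (hx : x ∈ D) (hτ : ∀ᵐ ω ∂(P x), exitTime D ω = contactTime φ 0 ω) :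
    m.restrict D ≪ occupationKernel P hφ α x := by
  refine Measure.AbsolutelyContinuous.mk fun B hB h0 => ?_
  set f : Rd d → ℝ≥0 := B.indicator 1 with hf
  have hfm : Measurable f := measurable_one.indicator hB
  have hfcoe : (fun y => (f y : ℝ≥0∞)) = B.indicator 1 := by
    ext y
    by_cases hy : y ∈ B <;> simp [hf, hy]
  have hker : ∫⁻ y, (f y : ℝ≥0∞) ∂(occupationKernel P hφ α x) = 0 := by
    rw [hfcoe, lintegral_indicator_one hB, h0]
  rw [lintegral_occupationKernel P hφ α hfm.coe_nnreal_ennreal] at hker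
  replace hker := (lintegral_eq_zero_iff ((measurable_expDensity α).mul
    (measurable_lintegral_beforeContact (P x) hφ hfm.coe_nnreal_ennreal))).1 hker
  have hres : resolvent P D 1 f x = 0 := by
    rw [resolvent]
    refine (lintegral_congr_ae ?_).trans lintegral_zero
    filter_upwards [hker] with t ht
    have hexp : ENNReal.ofReal (Real.exp (-α * t)) ≠ 0 := by
      simpa using Real.exp_pos _
    have h1 := (mul_eq_zero.1 ht).resolve_left hexp
    have h2 : killedSemigroup P D t.toNNReal f x = 0 := by
      rw [killedSemigroup, ← h1]
      refine lintegral_congr_ae ?_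
      filter_upwards [hτ] with ω hω
      simp only [indicator, mem_ofPred_eq, hω]
    rw [h2, mul_zero]
  by_contra hne
  refine (hIR f hfm ⟨1, fun y => ?_⟩ ?_ x hx).ne' hres
  · exact indicator_le_self' (fun _ _ => zero_le) y
  · rw [hfcoe, lintegral_indicator_one hB]
    exact pos_iff_ne_zero.2 hne

/-! ### Excessivity of the deficit of a subsolution -/

theorem measurable_integral_path {F : Rd d → ℝ} (hF : Measurable F) {T : CadlagPath d → ℝ≥0}
    (hT : Measurable T) :
    Measurable fun ω => ∫ r in (0 : ℝ)..T ω, F (X r.toNNReal ω) := by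
  have hS : MeasurableSet {p : CadlagPath d × ℝ | p.2 ∈ Ioc (0 : ℝ) (T p.1)} :=
    (measurableSet_lt measurable_const measurable_snd).inter
      (measurableSet_le measurable_snd (hT.comp measurable_fst).coe_nnreal_real)
  have hm : Measurable ({p : CadlagPath d × ℝ | p.2 ∈ Ioc (0 : ℝ) (T p.1)}.indicator
      fun p => F (X p.2.toNNReal p.1)) :=
    (hF.comp (measurable_X_real.comp measurable_swap)).indicator hS
  have h := (StronglyMeasurable.integral_prod_right (ν := volume)
    (f := fun (ω : CadlagPath d) (r : ℝ) =>
      {p : CadlagPath d × ℝ | p.2 ∈ Ioc (0 : ℝ) (T p.1)}.indicator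
        (fun p => F (X p.2.toNNReal p.1)) (ω, r)) hm.stronglyMeasurable).measurable
  convert h using 2 with ω
  rw [intervalIntegral.integral_of_le (T ω).coe_nonneg, ← integral_indicator measurableSet_Ioc]
  rfl

theorem IntegroDiffOp.closure_subset_extDomain (L : IntegroDiffOp d) (D : Set (Rd d)) :
    closure D ⊆ L.extDomain D := by
  rw [closure_eq_self_union_frontier]
  rintro y (hy | hy)
  · exact Or.inr hy
  · exact Or.inl (Or.inl hy)

theorem IntegroDiffOp.ae_add_mem_extDomain (L : IntegroDiffOp d) {D : Set (Rd d)} {y : Rd d}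
    (hy : y ∈ D) : ∀ᵐ z ∂(L.N y), y + z ∈ L.extDomain D := by
  filter_upwards [Measure.support_mem_ae (μ := L.N y)] with z hz
  by_cases hD : y + z ∈ D
  · exact Or.inr hD
  · exact Or.inl (Or.inr ⟨mem_iUnion₂.2 ⟨y, hy, z, hz, rfl⟩, hD⟩)

/-- The deficit `M - u` of a subsolution dominates its discounted means along the killed process.
The boundary values contribute nothing negative, because at the exit the process is in `D_S`, where
`u ≤ M`; the potential `c` enters with the right sign because `0 ≤ M`. -/
theorem IsWeakSubsolution.exp_mul_lintegral_le {L : IntegroDiffOp d}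
    {P : Kernel (Rd d) (CadlagPath d)} [IsMarkovKernel P] {D : Set (Rd d)} (hDo : IsOpen D)
    (hL : L.Admissible D) {φ : Rd d → ℝ} (hφ : Continuous φ) (hD : ∀ y, y ∈ D ↔ 0 < φ y)
    {x : Rd d} (hx : x ∈ D) (hμ : IsMartingaleSolution L (Measure.dirac x) (P x))
    (hτ : ∀ᵐ ω ∂(P x), exitTime D ω = contactTime φ 0 ω)
    {c g u : Rd d → ℝ} (hc_meas : Measurable (D.domRestrict c)) (hc_nonneg : ∀ y ∈ D, 0 ≤ c y)
    {C : ℝ} (hC : ∀ y ∈ D, c y ≤ C) (hu : IsWeakSubsolution P D c g u) {M : ℝ} (hM0 : 0 ≤ M)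
    (hM : ∀ y ∈ L.extDomain D, u y ≤ M) (t : ℝ≥0) :
    ENNReal.ofReal (Real.exp (-C * t)) *
      ∫⁻ ω, {ω | (t : ℝ≥0∞) < contactTime φ 0 ω}.indicator
        (fun ω => ENNReal.ofReal (M - u (X t ω))) ω ∂(P x) ≤ ENNReal.ofReal (M - u x) := by
  classical
  obtain ⟨Cu, hCu⟩ := hu.bounded
  have hC0 : 0 ≤ C := (hc_nonneg x hx).trans (hC x hx)
  set T : CadlagPath d → ℝ≥0 := contactTimeMin φ 0 t with hTdef
  have hTm : Measurable T := measurable_contactTimeMin hφ 0 t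
  -- outside `D` the function `c` need not be measurable
  set c' : Rd d → ℝ := D.indicator c with hc'
  have hc'm : Measurable c' := by
    refine measurable_of_restrict_of_restrict_compl hDo.measurableSet ?_ ?_
    · convert hc_meas using 1
      ext y
      exact indicator_of_mem y.2 c
    · convert measurable_const (a := (0 : ℝ)) using 1
      ext y
      exact indicator_of_notMem y.2 c
  set e : CadlagPath d → ℝ := fun ω => Real.exp (-∫ r in (0 : ℝ)..T ω, c' (X r.toNNReal ω)) with he
  have hem : Measurable e := (measurable_integral_path hc'm hTm).neg.exp
  have hec : ∀ ω, expFunctional c (T ω) ω = e ω := by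
    intro ω
    rw [expFunctional, he]
    congr 2
    refine intervalIntegral.integral_congr_ae ?_
    filter_upwards [ae_mem_of_le_contactTimeMin hD (le_refl (T ω))] with r hr hmem
    rw [hc', indicator_of_mem (hr hmem)]
  have hint_nonneg : ∀ ω, 0 ≤ ∫ r in (0 : ℝ)..T ω, c' (X r.toNNReal ω) := fun ω =>
    intervalIntegral.integral_nonneg (T ω).coe_nonneg fun r _ =>
      indicator_nonneg (fun y hy => hc_nonneg y hy) _
  have he1 : ∀ ω, e ω ≤ 1 := fun ω => Real.exp_le_one_iff.2 (neg_nonpos.2 (hint_nonneg ω))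
  have heC : ∀ ω, Real.exp (-C * t) ≤ e ω := by
    intro ω
    refine Real.exp_le_exp.2 ?_
    have h := abs_integral_path_le hD (le_refl (T ω)) (F := c') hC0 fun y hy => by
      rw [hc', indicator_of_mem hy, abs_of_nonneg (hc_nonneg y hy)]
      exact hC y hy
    rw [Real.norm_eq_abs] at h
    linarith [le_abs_self (∫ r in (0 : ℝ)..T ω, c' (X r.toNNReal ω))]
  have he0 : ∀ ω, 0 < e ω := fun ω => Real.exp_pos _
  have hTeq : ∀ᵐ ω ∂(P x), exitTimeMin D t ω = T ω := by
    filter_upwards [hτ] with ω hω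
    rw [exitTimeMin, hω, hTdef, contactTimeMin]
  have huT : ∀ᵐ ω ∂(P x), u (X (T ω) ω) ≤ M := by
    have h := ae_X_contactTimeMin_notMem_of_jumps hDo hL hφ hD hx hμ (U := {y | M < u y})
      (measurableSet_lt measurable_const hu.measurable)
      (disjoint_left.2 fun y hy hyD =>
        not_lt.2 (hM y (L.closure_subset_extDomain D hyD)) hy)
      (fun y hy => (L.ae_add_mem_extDomain hy).mono fun z hz => not_lt.2 (hM _ hz)) t
    filter_upwards [h] with ω hω using not_lt.1 hω
  have hint : Integrable (fun ω => e ω * u (X (T ω) ω)) (P x) := by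
    refine Integrable.of_bound
      (hem.mul (hu.measurable.comp (measurable_X_stopped hTm))).aestronglyMeasurable Cu
      (Eventually.of_forall fun ω => ?_)
    rw [Real.norm_eq_abs, abs_mul, abs_of_pos (he0 ω)]
    exact (mul_le_of_le_one_left (abs_nonneg _) (he1 ω)).trans (hCu _)
  have hux : u x ≤ ∫ ω, e ω * u (X (T ω) ω) ∂(P x) := by
    have h := hu.le x hx t
    have hcongr : ∫ ω, expFunctional c (exitTimeMin D t ω) ω * u (X (exitTimeMin D t ω) ω) ∂(P x)
        = ∫ ω, e ω * u (X (T ω) ω) ∂(P x) := by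
      refine integral_congr_ae ?_
      filter_upwards [hTeq] with ω hω
      rw [hω, hec]
    rw [hcongr] at h
    have h2 := h.trans (EReal.sub_le_sub le_rfl (EReal.coe_ennreal_nonneg _))
    rw [sub_zero] at h2
    exact_mod_cast h2
  have hG : ∀ᵐ ω ∂(P x), {ω | (t : ℝ≥0∞) < contactTime φ 0 ω}.indicator
      (fun ω => Real.exp (-C * t) * (M - u (X t ω))) ω ≤ M - e ω * u (X (T ω) ω) := by
    filter_upwards [huT] with ω hω
    have h1 : e ω * (M - u (X (T ω) ω)) ≤ M - e ω * u (X (T ω) ω) := by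
      nlinarith [he1 ω]
    have h2 : 0 ≤ M - u (X (T ω) ω) := sub_nonneg.2 hω
    refine le_trans ?_ h1
    by_cases hlt : (t : ℝ≥0∞) < contactTime φ 0 ω
    · rw [indicator_of_mem (by exact hlt)]
      have hTt : T ω = t := contactTimeMin_of_lt hlt
      rw [hTt] at h2 ⊢
      exact mul_le_mul_of_nonneg_right (heC ω) h2
    · rw [indicator_of_notMem (by exact hlt)]
      exact mul_nonneg (he0 ω).le h2
  have hGint : Integrable (fun ω => M - e ω * u (X (T ω) ω)) (P x) :=
    (integrable_const M).sub hint
  have hG0 : 0 ≤ᵐ[P x] fun ω => M - e ω * u (X (T ω) ω) := by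
    filter_upwards [huT] with ω hω
    have h2 : 0 ≤ M - u (X (T ω) ω) := sub_nonneg.2 hω
    have := he1 ω
    have := mul_nonneg (he0 ω).le h2
    simp only [Pi.zero_apply]
    nlinarith
  calc ENNReal.ofReal (Real.exp (-C * t)) *
        ∫⁻ ω, {ω | (t : ℝ≥0∞) < contactTime φ 0 ω}.indicator
          (fun ω => ENNReal.ofReal (M - u (X t ω))) ω ∂(P x)
      = ∫⁻ ω, ENNReal.ofReal (Real.exp (-C * t)) *
          {ω | (t : ℝ≥0∞) < contactTime φ 0 ω}.indicator
            (fun ω => ENNReal.ofReal (M - u (X t ω))) ω ∂(P x) :=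
        (lintegral_const_mul' _ _ ENNReal.ofReal_ne_top).symm
    _ ≤ ∫⁻ ω, ENNReal.ofReal (M - e ω * u (X (T ω) ω)) ∂(P x) := by
        refine lintegral_mono_ae ?_
        filter_upwards [hG] with ω hω
        by_cases hlt : (t : ℝ≥0∞) < contactTime φ 0 ω
        · rw [indicator_of_mem (by exact hlt)] at hω ⊢
          rw [← ENNReal.ofReal_mul (Real.exp_pos _).le]
          exact ENNReal.ofReal_le_ofReal hω
        · rw [indicator_of_notMem (by exact hlt), mul_zero]
          exact zero_le
    _ = ENNReal.ofReal (∫ ω, (M - e ω * u (X (T ω) ω)) ∂(P x)) :=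
        (ofReal_integral_eq_lintegral_ofReal hGint hG0).symm
    _ ≤ ENNReal.ofReal (M - u x) := by
        refine ENNReal.ofReal_le_ofReal ?_
        rw [integral_sub (integrable_const M) hint]
        simp only [integral_const, probReal_univ, smul_eq_mul, one_mul]
        linarith

theorem lintegral_exp_neg_Ioi :
    ∫⁻ t in Ioi (0 : ℝ), ENNReal.ofReal (Real.exp (-t)) = 1 := by
  rw [← ofReal_integral_eq_lintegral_ofReal
    (by simpa [IntegrableOn] using exp_neg_integrableOn_Ioi 0 one_pos)
    (Eventually.of_forall fun t => (Real.exp_pos _).le), integral_exp_neg_Ioi_zero,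
    ENNReal.ofReal_one]

/-- The deficit of a subsolution is excessive for the occupation kernel. -/
theorem lintegral_occupationKernel_le_of_forall_exp_mul_le {P : Kernel (Rd d) (CadlagPath d)}
    [IsMarkovKernel P] {φ : Rd d → ℝ} (hφ : Continuous φ) {C : ℝ} {x : Rd d} {w : Rd d → ℝ≥0∞}
    (hw : Measurable w)
    (h : ∀ t : ℝ≥0, ENNReal.ofReal (Real.exp (-C * t)) *
      ∫⁻ ω, {ω | (t : ℝ≥0∞) < contactTime φ 0 ω}.indicator
        (fun ω => w (X t ω)) ω ∂(P x) ≤ w x) :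
    ∫⁻ y, w y ∂(occupationKernel P hφ (1 + C) x) ≤ w x := by
  rw [lintegral_occupationKernel P hφ (1 + C) hw]
  calc _ ≤ ∫⁻ t in Ioi (0 : ℝ), ENNReal.ofReal (Real.exp (-t)) * w x := by
        refine setLIntegral_mono' measurableSet_Ioi fun t ht => ?_
        have h1 : ENNReal.ofReal (Real.exp (-(1 + C) * t)) =
            ENNReal.ofReal (Real.exp (-t)) * ENNReal.ofReal (Real.exp (-C * t.toNNReal)) := by
          rw [← ENNReal.ofReal_mul (Real.exp_pos _).le, ← Real.exp_add,
            Real.coe_toNNReal t (le_of_lt ht)]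
          ring_nf
        rw [h1, mul_assoc]
        exact mul_le_mul' le_rfl (h t.toNNReal)
    _ = w x := by
        rw [lintegral_mul_const _ (by fun_prop), lintegral_exp_neg_Ioi, one_mul]

end HopfLemma

/-! ### The uniform lower bound for the deficit -/

theorem theorem3p5 {d : ℕ} (D : Set (HopfLemma.Rd d)) (hD_open : IsOpen D)
    (hD_conn : IsConnected D)
    (L : HopfLemma.IntegroDiffOp d) (hL : L.Admissible D)
    (P : Kernel (HopfLemma.Rd d) (HopfLemma.CadlagPath d))
    (hP : HopfLemma.IsStrongMarkovSolution L P)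
    (hET : HopfLemma.ExitTimeFinite P D)
    (m : Measure (HopfLemma.Rd d)) [SigmaFinite m] (hm : m D ≠ 0)
    (hIR : HopfLemma.ResolventIrreducible P D m)
    (c : HopfLemma.Rd d → ℝ) (hc_meas : Measurable (D.domRestrict c))
    (hc_nonneg : ∀ x ∈ D, 0 ≤ c x) (hc_bdd : ∃ C : ℝ, ∀ x ∈ D, c x ≤ C) :
    ∃ ψ : D → ℝ, Measurable ψ ∧ (∀ x, 0 < ψ x) ∧
      ∀ g : HopfLemma.Rd d → ℝ, Measurable (D.domRestrict g) → (∀ x ∈ D, g x ≤ 0) →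
      ∀ u : HopfLemma.Rd d → ℝ, HopfLemma.IsWeakSubsolution P D c g u →
        (¬ ∃ k : ℝ, ∀ᵐ x ∂(m.restrict D), u x = k) →
        0 ≤ sSup (u '' L.extDomain D) →
        ∃ a : ℝ, 0 < a ∧ ∀ x : D, a * ψ x ≤ sSup (u '' L.extDomain D) - u x := by
  have := hP.isMarkovKernel
  obtain ⟨x₀, hx₀⟩ := hD_conn.nonempty
  -- the exit is certain, hence `D` is not the whole space
  have hne : (Dᶜ).Nonempty := by
    obtain ⟨ω, hω⟩ := (hET x₀ hx₀).exists
    simp only [HopfLemma.exitTime, iInf_lt_iff] at hω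
    obtain ⟨t, ht, -⟩ := hω
    exact ⟨_, ht.2⟩
  set φ : HopfLemma.Rd d → ℝ := fun y => Metric.infDist y Dᶜ
  have hφ : Continuous φ := Metric.continuous_infDist_pt _
  have hD : ∀ y, y ∈ D ↔ 0 < φ y := fun y => by
    rw [← hD_open.isClosed_compl.notMem_iff_infDist_pos hne, mem_compl_iff, not_not]
  have hτ : ∀ x ∈ D, ∀ᵐ ω ∂(P x), HopfLemma.exitTime D ω = HopfLemma.contactTime φ 0 ω := by
    intro x hx
    filter_upwards [HopfLemma.ae_X_zero_eq (hP.solution x),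
      HopfLemma.ae_X_contactTimeMin_notMem hD_open hL hφ hD (hP.solution x)] with ω h0 hω
    exact HopfLemma.exitTime_eq_contactTime hD (h0 ▸ hx) hω
  obtain ⟨C, hC⟩ := hc_bdd
  have hC0 : 0 ≤ C := (hc_nonneg x₀ hx₀).trans (hC x₀ hx₀)
  set K := HopfLemma.occupationKernel P hφ (1 + C)
  have : IsFiniteKernel K := HopfLemma.isFiniteKernel_occupationKernel P hφ (by linarith)
  have hacK : ∀ x ∈ D, m.restrict D ≪ K x := fun x hx =>
    HopfLemma.restrict_absolutelyContinuous_occupationKernel hIR hφ _ hx (hτ x hx)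
  set m' : Measure (HopfLemma.Rd d) := (m.restrict D).toFinite
  have hmm' : m' ≪ m.restrict D := toFinite_absolutelyContinuous _
  have hm'0 : m' ≠ 0 := by
    intro h0
    have h1 : m.restrict D univ = 0 := absolutelyContinuous_toFinite (m.restrict D) (by
      change m' univ = 0
      simp [h0])
    rw [Measure.restrict_apply_univ] at h1
    exact hm h1
  obtain ⟨B, hB, hBpos, hmin⟩ := HopfLemma.exists_common_minorant K hD_open.measurableSet m' hm'0
    (hmm' (by rw [Measure.restrict_apply hD_open.measurableSet.compl, compl_inter_self,
      measure_empty])) fun x hx => hmm'.trans (hacK x hx)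
  refine ⟨fun x => (K x B).toReal, ?_, fun x => ?_, ?_⟩
  · exact ((Kernel.measurable_coe K hB).comp measurable_subtype_coe).ennreal_toReal
  · exact ENNReal.toReal_pos (hBpos x x.2).ne' (measure_ne_top _ _)
  intro g _ _ u hu hnc hM0
  set M := sSup (u '' L.extDomain D)
  obtain ⟨Cu, hCu⟩ := hu.bounded
  have hM : ∀ y ∈ L.extDomain D, u y ≤ M := fun y hy => by
    refine le_csSup ⟨Cu, ?_⟩ (mem_image_of_mem u hy)
    rintro _ ⟨z, -, rfl⟩
    exact (le_abs_self _).trans (hCu z)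
  have hMD : ∀ y ∈ D, u y ≤ M := fun y hy => hM y (Or.inr hy)
  set w : HopfLemma.Rd d → ℝ≥0∞ := fun y => ENNReal.ofReal (M - u y)
  have hw : Measurable w := (measurable_const.sub hu.measurable).ennreal_ofReal
  have hKw : ∀ x ∈ D, ∫⁻ y, w y ∂(K x) ≤ w x := fun x hx =>
    HopfLemma.lintegral_occupationKernel_le_of_forall_exp_mul_le hφ hw fun t =>
      hu.exp_mul_lintegral_le hD_open hL hφ hD hx (hP.solution x) (hτ x hx) hc_meas hc_nonneg hC
        hM0 hM t
  have hwpos : ∀ x ∈ D, 0 < w x := by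
    intro x hx
    refine lt_of_lt_of_le (pos_iff_ne_zero.2 fun h0 => hnc ⟨M, ?_⟩) (hKw x hx)
    have h1 : ∀ᵐ y ∂(K x), w y = 0 := (lintegral_eq_zero_iff hw).1 h0
    filter_upwards [(hacK x hx).ae_le h1, ae_restrict_mem hD_open.measurableSet] with y hy hyD
    exact le_antisymm (hMD y hyD) (sub_nonpos.1 (ENNReal.ofReal_eq_zero.1 hy))
  obtain ⟨a, ha, hatop, hle⟩ := hmin w hw hwpos hKw
  refine ⟨a.toReal, ENNReal.toReal_pos ha.ne' hatop, fun x => ?_⟩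
  rw [← ENNReal.toReal_mul]
  exact ENNReal.toReal_le_of_le_ofReal (sub_nonneg.2 (hMD x x.2)) (hle x x.2)
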